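/- Fix the following notions. A formal series over a finite alphabet $\Sigma$ is a map $f:\Sigma^*\to\mathbb Q$, written $w\mapsto f_w$. Its left and right derivatives by a letter $a$ are the series $(\delta^L_a f)_w=f_{aw}$ and $(\delta^R_a f)_w=f_{wa}$, and its reversal is $f^R_w=f_{w^R}$. A series $f$ is commutative if $f_u=f_v$ whenever $u,v$ are permutations of each other. A class of series is a family $\mathcal S=(\mathcal S_\Sigma)_\Sigma$ with $\mathcal S_\Sigma\subseteq\mathbb Q^{\Sigma^*}$ for every finite alphabet $\Sigma$. It is a prevariety if every $\mathcal S_\Sigma$ is a linear subspace closed under all left and right derivatives. It is an effective prevariety with respect to a system of finite presentations if it is a prevariety, the series that have a presentation are exactly those of the class, presentations of $f+g$, $c\cdot f$ ($c\in\mathbb Q$), $\delta^L_a f$, $\delta^R_a f$ can be computed from presentations of $f$ and $g$ (and from $c$, $a$), and it is decidable whether two presentations over the same alphabet present the same series; the algorithms are uniform in the alphabet. A polynomial automaton has states $\mathbb Q^k$, an initial state $q_I\in\mathbb Q^k$, for every letter $a$ a polynomial map $\Delta^a:\mathbb Q^k\to\mathbb Q^k$, and a polynomial output map $F:\mathbb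 Q^k\to\mathbb Q$. It recognises the series $w\mapsto F(q_I\cdot w)$, where $q\cdot\varepsilon=q$ and $q\cdot(aw)=\Delta^a(q)\cdot w$. A Hadamard, shuffle, or infiltration automaton has nonterminals $X=\{X_1,\dots,X_k\}$ with $k\ge 1$, an output function $F:X\to\mathbb Q$, and a transition function $\Delta_a:X\to\mathbb Q[X]$ for every letter $a$. The function $F$ is extended to $\mathbb Q[X]$ by polynomial evaluation, and $\Delta_a$ is extended linearly to $\mathbb Q[X]$: as a $\mathbb Q$-algebra endomorphism (Hadamard); as a derivation (shuffle); with $\Delta_a 1=0$ and $\Delta_a(\alpha\beta)=\Delta_a(\alpha)\beta+\alpha\Delta_a(\beta)+\Delta_a(\alpha)\Delta_a(\beta)$ (infiltration). With $\Delta_\varepsilon\alpha=\alpha$ and $\Delta_{aw}\alpha=\Delta_w\Delta_a\alpha$, the automaton recognises the series $w\mapsto F(\Delta_w X_1)$. The infiltration product $f\uparrow g$ of two series is defined by $(f\uparrow g)_\varepsilon=f_\varepsilon g_\varepsilon$ and $\delta^L_a(f\uparrow g)=\delta^L_a f\uparrow g+f\uparrow\delta^L_a g+\delta^L_a f\uparrow\delta^L_a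 g$. Its unit is $1\cdot\varepsilon$. A series is infiltration finite if it belongs to a finitely generated infiltration algebra of series that is closed under left derivatives. **Theorem.** Series being presented by automata of the respective kind (with rational coefficients, polynomials being given by finite lists of terms): 1. the series recognised by polynomial automata form an effective prevariety; so do the series recognised by Hadamard automata; and a series $f$ is recognised by a polynomial automaton if and only if $f^R$ is recognised by a Hadamard automaton; 2. the series recognised by shuffle automata form an effective prevariety; 3. the series recognised by infiltration automata form an effective prevariety; the infiltration-finite series, presented by infiltration automata, form an effective prevariety too. Consequently, it is decidable whether the series recognised by a given polynomial (respectively Hadamard, shuffle, infiltration) automaton is commutative. -/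

import Mathlib

open MvPolynomial

noncomputable section

/-! ### Formal series -/

/-- Formal series over the rationals in noncommuting variables `A`: functions from words to `ℚ`.
Addition, scalar product and the zero series are the pointwise ones. -/
abbrev Series (A : Type) : Type := List A → ℚ

namespace Series

variable {A : Type}

/-- The left derivative: the coefficient of `w` in it is the coefficient of `a w` in `f`. -/
def leftDeriv (a : A) (f : Series A) : Series A := fun w => f (a :: w)

/-- The right derivative: the coefficient of `w` in it is the coefficient of `w a` in `f`. -/
def rightDeriv (a : A) (f : Series A) : Series A := fun w => f (w ++ [a])

/-- The reversal of a series. -/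
def reversal (f : Series A) : Series A := fun w => f w.reverse

/-- A series is commutative if words that are permutations of each other
have the same coefficient. -/
def IsCommutative (f : Series A) : Prop := ∀ u v : List A, u.Perm v → f u = f v

/-- The series `1 · ε`. -/
def unit : Series A
  | [] => 1
  | _ :: _ => 0

/-- Coefficients of the infiltration product, by recursion on the word. -/
def infiltrationCoeff : List A → Series A → Series A → ℚ
  | [], f, g => f [] * g []
  | a :: w, f, g =>
      infiltrationCoeff w (leftDeriv a f) g + infiltrationCoeff w f (leftDeriv a g)
        + infiltrationCoeff w (leftDeriv a f) (leftDeriv a g)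

/-- The infiltration product of two series. -/
def infiltration (f g : Series A) : Series A := fun w => infiltrationCoeff w f g

theorem infiltration_nil (f g : Series A) : infiltration f g [] = f [] * g [] := rfl

theorem leftDeriv_infiltration (a : A) (f g : Series A) :
    leftDeriv a (infiltration f g) =
      infiltration (leftDeriv a f) g + infiltration f (leftDeriv a g)
        + infiltration (leftDeriv a f) (leftDeriv a g) := rfl

/-- The (unital) infiltration subalgebra generated by a set of series. -/
inductive InfiltrationAdjoin (G : Set (Series A)) : Series A → Prop
  | gen (f : Series A) : f ∈ G → InfiltrationAdjoin G f
  | one : InfiltrationAdjoin G unit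
  | add (f g : Series A) :
      InfiltrationAdjoin G f → InfiltrationAdjoin G g → InfiltrationAdjoin G (f + g)
  | smul (c : ℚ) (f : Series A) : InfiltrationAdjoin G f → InfiltrationAdjoin G (c • f)
  | mul (f g : Series A) :
      InfiltrationAdjoin G f → InfiltrationAdjoin G g → InfiltrationAdjoin G (infiltration f g)

/-- A series is infiltration finite if it belongs to a finitely generated infiltration algebra
of series that is closed under left derivatives. -/
def IsInfiltrationFinite (f : Series A) : Prop :=
  ∃ G : Set (Series A), G.Finite ∧ InfiltrationAdjoin G f ∧
    ∀ (a : A) (g : Series A), InfiltrationAdjoin G g → InfiltrationAdjoin G (leftDeriv a g)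

end Series

/-! ### Hadamard, shuffle and infiltration automata -/

/-- The common syntax of Hadamard, shuffle and infiltration automata over the alphabet `A`:
nonterminals `X 0, …, X k` of which `X 0` is the distinguished one, an output function, and
a transition function. -/
structure ProductAutomaton (A : Type) where
  k : ℕ
  output : Fin (k + 1) → ℚ
  step : A → Fin (k + 1) → MvPolynomial (Fin (k + 1)) ℚ

/-- The three products of series that give a semantics to the syntax above. -/
inductive ProductKind
  | hadamard
  | shuffle
  | infiltration

/-- The linear extension to all polynomials of a map `s` on the variables: as an algebra
endomorphism (Hadamard), as a derivation (shuffle), and by the product rule of the infiltration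
product, `Δ (α β) = Δ α · β + α · Δ β + Δ α · Δ β` with `Δ 1 = 0`, that is, such that `1 + Δ` is
an algebra endomorphism (infiltration). -/
def ProductKind.extend {σ : Type} (s : σ → MvPolynomial σ ℚ) :
    ProductKind → MvPolynomial σ ℚ →ₗ[ℚ] MvPolynomial σ ℚ
  | .hadamard => (aeval s).toLinearMap
  | .shuffle => (mkDerivation ℚ s).toLinearMap
  | .infiltration => (aeval fun i => X i + s i).toLinearMap - LinearMap.id

/-- The extension used for infiltration automata satisfies its defining properties. -/
theorem ProductKind.extend_infiltration {σ : Type} (s : σ → MvPolynomial σ ℚ) :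
    (∀ i, ProductKind.infiltration.extend s (X i) = s i) ∧
    ProductKind.infiltration.extend s 1 = 0 ∧
    ∀ α β, ProductKind.infiltration.extend s (α * β) =
      ProductKind.infiltration.extend s α * β + α * ProductKind.infiltration.extend s β
        + ProductKind.infiltration.extend s α * ProductKind.infiltration.extend s β := by
  refine ⟨fun i => ?_, ?_, fun α β => ?_⟩
  · simp [ProductKind.extend]
  · simp [ProductKind.extend]
  · simp only [ProductKind.extend, LinearMap.sub_apply, AlgHom.toLinearMap_apply, map_mul,
      LinearMap.id_apply]
    ring

/-- The extension used for infiltration automata is the only one with these properties. -/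
theorem ProductKind.extend_infiltration_unique {σ : Type} (s : σ → MvPolynomial σ ℚ)
    (D : MvPolynomial σ ℚ →ₗ[ℚ] MvPolynomial σ ℚ) (hX : ∀ i, D (X i) = s i) (h_one : D 1 = 0)
    (hmul : ∀ α β, D (α * β) = D α * β + α * D β + D α * D β) :
    D = ProductKind.infiltration.extend s := by
  let S : MvPolynomial σ ℚ →ₐ[ℚ] MvPolynomial σ ℚ :=
    AlgHom.ofLinearMap (LinearMap.id + D) (by simp [h_one]) (fun α β => by
      simp only [LinearMap.add_apply, LinearMap.id_apply, hmul]
      ring)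
  have hS : S = aeval fun i => X i + s i := by
    apply MvPolynomial.algHom_ext
    intro i
    simp [S, hX]
  apply LinearMap.ext
  intro p
  have h2 : p + D p = aeval (fun i => X i + s i) p := by
    rw [← hS]
    rfl
  simp only [ProductKind.extend, LinearMap.sub_apply, AlgHom.toLinearMap_apply,
    LinearMap.id_apply, ← h2]
  ring

namespace ProductAutomaton

variable {A : Type}

/-- The extension of transitions to words, `Δ_ε α = α` and `Δ_(a w) α = Δ_w (Δ_a α)`. -/
def run (M : ProductAutomaton A) (κ : ProductKind) (w : List A)
    (α : MvPolynomial (Fin (M.k + 1)) ℚ) : MvPolynomial (Fin (M.k + 1)) ℚ :=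
  w.foldl (fun β a => κ.extend (M.step a) β) α

/-- The series of a configuration: `w` is mapped to the output of `Δ_w α`. -/
def configSeries (M : ProductAutomaton A) (κ : ProductKind)
    (α : MvPolynomial (Fin (M.k + 1)) ℚ) : Series A :=
  fun w => eval M.output (M.run κ w α)

/-- The series recognised by the automaton is that of its distinguished nonterminal. -/
def series (M : ProductAutomaton A) (κ : ProductKind) : Series A := M.configSeries κ (X 0)

end ProductAutomaton

/-! ### Polynomial automata -/

/-- Polynomial automata over the alphabet `A`, with states in `ℚ ^ k`, an initial state,
polynomial transitions and a polynomial output function. -/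
structure PolynomialAutomaton (A : Type) where
  k : ℕ
  init : Fin k → ℚ
  step : A → Fin k → MvPolynomial (Fin k) ℚ
  output : MvPolynomial (Fin k) ℚ

namespace PolynomialAutomaton

variable {A : Type}

/-- The state reached from `q` by reading a word from left to right. -/
def act (M : PolynomialAutomaton A) (q : Fin M.k → ℚ) (w : List A) : Fin M.k → ℚ :=
  w.foldl (fun r a i => eval r (M.step a i)) q

/-- The series recognised by the automaton. -/
def series (M : PolynomialAutomaton A) : Series A := fun w => eval (M.act M.init w) M.output

end PolynomialAutomaton

/-! ### Classes of series -/

/-- A class of series: a set of series over every finite alphabet. -/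
abbrev SeriesClass : Type 1 := ∀ (A : Type) [Finite A], Set (Series A)

/-- The series recognised by Hadamard automata, shuffle automata, or infiltration automata. -/
def recognised (κ : ProductKind) : SeriesClass :=
  fun A _ => {f | ∃ M : ProductAutomaton A, M.series κ = f}

/-- The series recognised by polynomial automata. -/
def recognisedPolynomial : SeriesClass := fun A _ => {f | ∃ M : PolynomialAutomaton A, M.series = f}

/-- The infiltration-finite series. -/
def infiltrationFinite : SeriesClass := fun _ _ => {f | f.IsInfiltrationFinite}

/-- Prevarieties of series. -/
structure IsPrevariety (S : SeriesClass) : Prop where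
  zero_mem : ∀ (A : Type) [Finite A], (0 : Series A) ∈ S A
  add_mem : ∀ (A : Type) [Finite A] (f g : Series A), f ∈ S A → g ∈ S A → f + g ∈ S A
  smul_mem : ∀ (A : Type) [Finite A] (c : ℚ) (f : Series A), f ∈ S A → c • f ∈ S A
  leftDeriv_mem : ∀ (A : Type) [Finite A] (a : A) (f : Series A), f ∈ S A → f.leftDeriv a ∈ S A
  rightDeriv_mem : ∀ (A : Type) [Finite A] (a : A) (f : Series A), f ∈ S A → f.rightDeriv a ∈ S A

/-! ### Finite presentations -/

/-- Presentation of rational numbers. -/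
abbrev RatCode : Type := ℕ × ℕ × ℕ

/-- The rational number presented by `(a, b, c)` is `(a - b) / (c + 1)`. -/
def RatCode.val (q : RatCode) : ℚ := ((q.1 : ℚ) - (q.2.1 : ℚ)) / ((q.2.2 : ℚ) + 1)

/-- Presentation of polynomials as lists of terms; a term is a coefficient together with
the list of the (indices of the) variables in it, with multiplicities. -/
abbrev PolyCode : Type := List (RatCode × List ℕ)

/-- The polynomial in `k` variables presented by a list of terms.
An index that is not below `k` is read as the polynomial `0`. -/
def PolyCode.toPoly (k : ℕ) (p : PolyCode) : MvPolynomial (Fin k) ℚ :=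
  (p.map fun t => C (RatCode.val t.1) *
    (t.2.map fun i => if h : i < k then (X ⟨i, h⟩ : MvPolynomial (Fin k) ℚ) else 0).prod).sum

/-- Presentation of Hadamard, shuffle and infiltration automata: the number `k`, the table of the
output function, and the tables of the transition function, one for each letter. -/
abbrev ProductAutomatonCode : Type := ℕ × List RatCode × List (List PolyCode)

/-- The automaton over the alphabet `{0, …, d - 1}` presented by a code.
Entries missing from the tables are read as zero. -/
def ProductAutomatonCode.toAutomaton (d : ℕ) (c : ProductAutomatonCode) :
    ProductAutomaton (Fin d) where
  k := c.1
  output := fun i => RatCode.val (c.2.1.getD i (0, 0, 0))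
  step := fun a i => PolyCode.toPoly (c.1 + 1) ((c.2.2.getD a []).getD i [])

/-- Presentation of polynomial automata: the dimension, the initial state, the tables of the
transition function, one for each letter, and the output polynomial. -/
abbrev PolynomialAutomatonCode : Type := ℕ × List RatCode × List (List PolyCode) × PolyCode

/-- The polynomial automaton over the alphabet `{0, …, d - 1}` presented by a code.
Entries missing from the tables are read as zero. -/
def PolynomialAutomatonCode.toAutomaton (d : ℕ) (c : PolynomialAutomatonCode) :
    PolynomialAutomaton (Fin d) where
  k := c.1
  init := fun i => RatCode.val (c.2.1.getD i (0, 0, 0))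
  step := fun a i => PolyCode.toPoly c.1 ((c.2.2.1.getD a []).getD i [])
  output := PolyCode.toPoly c.1 c.2.2.2

/-- The series over `{0, …, d - 1}` recognised by the automaton presented by a code. -/
def ProductAutomatonCode.series (κ : ProductKind) (d : ℕ) (c : ProductAutomatonCode) :
    Series (Fin d) := (ProductAutomatonCode.toAutomaton d c).series κ

/-- The series over `{0, …, d - 1}` recognised by the polynomial automaton presented by a code. -/
def PolynomialAutomatonCode.series (d : ℕ) (c : PolynomialAutomatonCode) :
    Series (Fin d) := (PolynomialAutomatonCode.toAutomaton d c).series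

/-! Every rational number, every polynomial and every automaton over `{0, …, d - 1}` has
a presentation. -/

theorem RatCode.val_surjective : Function.Surjective RatCode.val := by
  intro q
  refine ⟨(q.num.toNat, (-q.num).toNat, q.den - 1), ?_⟩
  have h1 : ((q.num.toNat : ℚ) - ((-q.num).toNat : ℚ)) = (q.num : ℚ) := by
    have h : (q.num.toNat : ℤ) - ((-q.num).toNat : ℤ) = q.num := by omega
    exact_mod_cast h
  have h2 : (((q.den - 1 : ℕ) : ℚ) + 1) = (q.den : ℚ) := by
    have h : q.den - 1 + 1 = q.den := Nat.succ_pred_eq_of_pos q.pos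
    exact_mod_cast h
  simp only [RatCode.val]
  rw [h1, h2]
  exact Rat.num_div_den q

theorem PolyCode.toPoly_surjective (k : ℕ) : Function.Surjective (PolyCode.toPoly k) := by
  intro p
  induction p using MvPolynomial.monomial_add_induction_on with
  | C a =>
    obtain ⟨q, hq⟩ := RatCode.val_surjective a
    exact ⟨[(q, [])], by simp [PolyCode.toPoly, hq]⟩
  | monomial_add s b f _ _ ih =>
    obtain ⟨c, hc⟩ := ih
    obtain ⟨q, hq⟩ := RatCode.val_surjective b
    refine ⟨(q, s.toMultiset.toList.map fun i => i.val) :: c, ?_⟩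
    have h : PolyCode.toPoly k c = f := hc
    have e : ((s.toMultiset.toList.map fun i => i.val).map fun i =>
        if h : i < k then (X ⟨i, h⟩ : MvPolynomial (Fin k) ℚ) else 0).prod = monomial s 1 := by
      have e1 : ((s.toMultiset.toList.map fun i => i.val).map fun i =>
          if h : i < k then (X ⟨i, h⟩ : MvPolynomial (Fin k) ℚ) else 0)
          = s.toMultiset.toList.map fun i => X i := by
        simp
      rw [e1, ← Multiset.prod_coe, ← Multiset.map_coe, Multiset.coe_toList,
        Finsupp.toMultiset_map, Finsupp.prod_toMultiset, MvPolynomial.monomial_eq]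
      rw [Finsupp.prod_mapDomain_index (by simp) (fun _ _ _ => pow_add _ _ _)]
      simp
    rw [← h]
    simp only [PolyCode.toPoly, List.map_cons, List.sum_cons, e, hq, C_mul_monomial, mul_one]

theorem ProductAutomatonCode.toAutomaton_surjective (d : ℕ) :
    Function.Surjective (ProductAutomatonCode.toAutomaton d) := by
  rintro ⟨k, F, D⟩
  choose q hq using fun i => RatCode.val_surjective (F i)
  choose p hp using fun a i => PolyCode.toPoly_surjective (k + 1) (D a i)
  refine ⟨(k, List.ofFn q, List.ofFn fun a => List.ofFn (p a)), ?_⟩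
  simp only [ProductAutomatonCode.toAutomaton]
  congr 1
  · funext i
    simp [-List.ofFn_succ, List.getD_eq_getElem?_getD, Fin.is_le i, hq]
  · funext a i
    simp [-List.ofFn_succ, List.getD_eq_getElem?_getD, Fin.is_le i, hp]

theorem PolynomialAutomatonCode.toAutomaton_surjective (d : ℕ) :
    Function.Surjective (PolynomialAutomatonCode.toAutomaton d) := by
  rintro ⟨k, F, D, G⟩
  choose q hq using fun i => RatCode.val_surjective (F i)
  choose p hp using fun a i => PolyCode.toPoly_surjective k (D a i)
  obtain ⟨g, hg⟩ := PolyCode.toPoly_surjective k G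
  refine ⟨(k, List.ofFn q, List.ofFn fun a => List.ofFn (p a), g), ?_⟩
  simp only [PolynomialAutomatonCode.toAutomaton]
  congr 1
  · funext i
    simp [-List.ofFn_succ, List.getD_eq_getElem?_getD, hq]
  · funext a i
    simp [-List.ofFn_succ, List.getD_eq_getElem?_getD, hp]

/-! ### Effective prevarieties -/

/-- The class `S` is an effective prevariety, its series being presented by the elements of `R`:
the element `r` presents over the alphabet `{0, …, d - 1}` the series `sem d r`.
It is a prevariety; its series are, up to an enumeration of the alphabet, exactly those
that have a presentation; sums, scalar products, left and right derivatives can be computed on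
presentations; and equality of presented series is decidable. The algorithms are uniform in the
size `d` of the alphabet, which is part of their input. -/
structure IsEffectivePrevariety (S : SeriesClass) {R : Type} [Primcodable R]
    (sem : (d : ℕ) → R → Series (Fin d)) : Prop where
  isPrevariety : IsPrevariety S
  mem_iff : ∀ (A : Type) [Finite A] (d : ℕ) (e : Fin d ≃ A) (f : Series A),
    f ∈ S A ↔ ∃ r : R, sem d r = fun w => f (w.map e)
  computable_add : ∃ op : ℕ × R × R → R, Computable op ∧
    ∀ d r s, sem d (op (d, r, s)) = sem d r + sem d s
  computable_smul : ∃ op : ℕ × RatCode × R → R, Computable op ∧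
    ∀ d c r, sem d (op (d, c, r)) = RatCode.val c • sem d r
  computable_leftDeriv : ∃ op : ℕ × ℕ × R → R, Computable op ∧
    ∀ d (a : Fin d) r, sem d (op (d, a, r)) = (sem d r).leftDeriv a
  computable_rightDeriv : ∃ op : ℕ × ℕ × R → R, Computable op ∧
    ∀ d (a : Fin d) r, sem d (op (d, a, r)) = (sem d r).rightDeriv a
  decidable_eq : ComputablePred fun x : ℕ × R × R => sem x.1 x.2.1 = sem x.1 x.2.2

/-- The commutativity problem for series presented through `sem` is decidable. -/
def CommutativityDecidable {R : Type} [Primcodable R]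
    (sem : (d : ℕ) → R → Series (Fin d)) : Prop :=
  ComputablePred fun x : ℕ × R => (sem x.1 x.2).IsCommutative

end

/-!
The three kinds of product automata are treated at once, by means of the product rule
`Δ (α β) = c • (Δ α · Δ β) + c' • (Δ α · β + α · Δ β)` with coefficients that depend on the kind
(`ProductKind.extend_mul`).

*Closure.* Sums, scalar multiples and left derivatives of recognised series are the series of
configurations `α`, possibly of a disjoint union of two automata; adding a nonterminal that behaves
like `α` turns them into recognised series (`AutomatonTable.series_pointed`). For right derivatives
by `a`, every nonterminal `X` gets a companion that stands for `δ^R_a X`. The operator `δ^R_a`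
obeys the same product rule as the transitions and commutes with them, which dictates the
transitions of the companions (`AutomatonTable.config_rightAutomaton`). These constructions are
primitive recursive on presentations.

*Equality.* By closure it suffices to decide whether a presented series is zero. Its being nonzero
is witnessed by a word. Its being zero is witnessed by an ideal that contains the distinguished
nonterminal, is mapped into itself by the transitions, and on which the output vanishes. The
ideal generated by the configurations reached from the distinguished nonterminal is one, and it is
finitely generated by Hilbert's basis theorem. Invariance is checked on generators, by means of
the coefficients of linear combinations. Hence both zeroness and its negation are recursively
enumerable, and Post's theorem applies (`ProductAutomatonCode.computablePred_series_eq_zero`).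

*Commutativity.* A series `f` is commutative if and only if `δ^L_b δ^L_a f = δ^L_a δ^L_b f` and
`δ^L_a f = δ^R_a f` for all letters (`Series.isCommutative_iff`), since the permutations of a word
are generated by the exchange of the first two letters and the rotation.

*Polynomial automata.* Evaluating a composition of polynomial maps from the other end shows that
they recognise the reversals of the series recognised by Hadamard automata
(`PolynomialAutomaton.series_eq_config`).

*Infiltration-finite series.* They are the series recognised by infiltration automata
(`infiltrationFinite_eq_recognised`). The binomial transform, which turns the infiltration product
into the pointwise product, makes it possible to speak of polynomials in series without making the
series a ring.
-/

/-! ### Product rules and configuration series -/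

namespace ProductKind

/-- The coefficient of `Δ α * Δ β` in the product rule for `Δ (α * β)`. -/
def diagCoeff : ProductKind → ℕ
  | .hadamard => 1
  | .shuffle => 0
  | .infiltration => 1

/-- The coefficient of `Δ α * β + α * Δ β` in the product rule for `Δ (α * β)`. -/
def sideCoeff : ProductKind → ℕ
  | .hadamard => 0
  | .shuffle => 1
  | .infiltration => 1

/-- The value of `Δ` at the polynomial `1`. -/
def oneCoeff : ProductKind → ℕ
  | .hadamard => 1
  | .shuffle => 0
  | .infiltration => 0

variable {σ τ : Type} (κ : ProductKind)

@[simp]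
theorem extend_X (s : σ → MvPolynomial σ ℚ) (i : σ) : κ.extend s (X i) = s i := by
  cases κ <;> simp [ProductKind.extend]

theorem extend_C (s : σ → MvPolynomial σ ℚ) (c : ℚ) :
    κ.extend s (C c) = κ.oneCoeff • C c := by
  cases κ <;> simp [ProductKind.extend, oneCoeff, MvPolynomial.algebraMap_eq]

/-- The three product rules, written uniformly. -/
theorem extend_mul (s : σ → MvPolynomial σ ℚ) (α β : MvPolynomial σ ℚ) :
    κ.extend s (α * β) = κ.diagCoeff • (κ.extend s α * κ.extend s β)
      + κ.sideCoeff • (κ.extend s α * β + α * κ.extend s β) := by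
  cases κ
  · simp [ProductKind.extend, diagCoeff, sideCoeff]
  · simp [ProductKind.extend, diagCoeff, sideCoeff, Derivation.leibniz]
    ring
  · rw [(extend_infiltration s).2.2]
    simp [diagCoeff, sideCoeff]
    ring

theorem extend_C_mul (s : σ → MvPolynomial σ ℚ) (c : ℚ) (α : MvPolynomial σ ℚ) :
    κ.extend s (C c * α) = C c * κ.extend s α := by
  rw [← smul_eq_C_mul, map_smul, smul_eq_C_mul]

/-- An algebra homomorphism intertwines two extensions if it does so on the variables. -/
theorem extend_algHom (φ : MvPolynomial σ ℚ →ₐ[ℚ] MvPolynomial τ ℚ)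
    {s : σ → MvPolynomial σ ℚ} {t : τ → MvPolynomial τ ℚ}
    (h : ∀ i, κ.extend t (φ (X i)) = φ (s i)) (α : MvPolynomial σ ℚ) :
    κ.extend t (φ α) = φ (κ.extend s α) := by
  induction α using MvPolynomial.induction_on with
  | C c =>
    have hc : φ (C c) = C c := φ.commutes c
    rw [hc, extend_C, extend_C, map_nsmul, hc]
  | add p q hp hq => simp only [map_add, hp, hq]
  | mul_X p i hp =>
    simp only [map_mul, extend_mul, hp, h, extend_X, map_add, map_nsmul]

/-- Two extensions commute on the range of an algebra homomorphism if they commute on the images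
of the variables and the first one preserves the range. -/
theorem extend_commute (φ : MvPolynomial σ ℚ →ₐ[ℚ] MvPolynomial τ ℚ)
    {s : σ → MvPolynomial σ ℚ} {t r : τ → MvPolynomial τ ℚ}
    (h : ∀ i, κ.extend t (φ (X i)) = φ (s i))
    (hr : ∀ i, κ.extend t (κ.extend r (φ (X i))) = κ.extend r (φ (s i)))
    (α : MvPolynomial σ ℚ) :
    κ.extend t (κ.extend r (φ α)) = κ.extend r (φ (κ.extend s α)) := by
  simp only [← κ.extend_algHom φ h] at hr ⊢
  have hr' : ∀ i, κ.extend t (κ.extend r (φ (X i))) = κ.extend r (κ.extend t (φ (X i))) :=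
    fun i => by rw [hr, h]
  induction α using MvPolynomial.induction_on with
  | C c =>
    have hc : φ (C c) = C c := φ.commutes c
    simp only [hc, extend_C, map_nsmul]
  | add p q hp hq => simp only [map_add, hp, hq]
  | mul_X p i hp =>
    simp only [map_mul, extend_mul, map_add, map_nsmul, hp, hr']
    ring

/-- The transition along a word: the letters act one after the other, the first one first. -/
noncomputable def extendWord {L : Type} (s : L → σ → MvPolynomial σ ℚ) (w : List L)
    (α : MvPolynomial σ ℚ) : MvPolynomial σ ℚ :=
  w.foldl (fun β a => κ.extend (s a) β) α

/-- The series of the configuration `α` of an automaton whose nonterminals and letters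
are taken from arbitrary types, with transition function `s` and output function `F`. -/
noncomputable def config {L : Type} (s : L → σ → MvPolynomial σ ℚ) (F : σ → ℚ) (w : List L)
    (α : MvPolynomial σ ℚ) : ℚ :=
  eval F (κ.extendWord s w α)

variable {L : Type}

theorem extendWord_cons (s : L → σ → MvPolynomial σ ℚ) (a : L) (w : List L)
    (α : MvPolynomial σ ℚ) :
    κ.extendWord s (a :: w) α = κ.extendWord s w (κ.extend (s a) α) := rfl

theorem config_nil (s : L → σ → MvPolynomial σ ℚ) (F : σ → ℚ) (α : MvPolynomial σ ℚ) :
    κ.config s F [] α = eval F α := rfl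

theorem config_cons (s : L → σ → MvPolynomial σ ℚ) (F : σ → ℚ) (a : L) (w : List L)
    (α : MvPolynomial σ ℚ) :
    κ.config s F (a :: w) α = κ.config s F w (κ.extend (s a) α) := rfl

theorem config_concat (s : L → σ → MvPolynomial σ ℚ) (F : σ → ℚ) (a : L) (w : List L)
    (α : MvPolynomial σ ℚ) :
    κ.config s F (w ++ [a]) α = eval F (κ.extend (s a) (κ.extendWord s w α)) := by
  simp [config, extendWord]

theorem config_map {L' : Type} (m : L → L') (s : L' → σ → MvPolynomial σ ℚ) (F : σ → ℚ)
    (w : List L) (α : MvPolynomial σ ℚ) :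
    κ.config s F (w.map m) α = κ.config (fun a => s (m a)) F w α := by
  simp [config, extendWord, List.foldl_map]

theorem extendWord_add (s : L → σ → MvPolynomial σ ℚ) (w : List L) (α β : MvPolynomial σ ℚ) :
    κ.extendWord s w (α + β) = κ.extendWord s w α + κ.extendWord s w β := by
  induction w generalizing α β with
  | nil => rfl
  | cons a w ih => simp only [extendWord_cons, map_add, ih]

theorem extendWord_smul (s : L → σ → MvPolynomial σ ℚ) (w : List L) (c : ℚ)
    (α : MvPolynomial σ ℚ) : κ.extendWord s w (c • α) = c • κ.extendWord s w α := by
  induction w generalizing α with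
  | nil => rfl
  | cons a w ih => simp only [extendWord_cons, map_smul, ih]

theorem config_add (s : L → σ → MvPolynomial σ ℚ) (F : σ → ℚ) (w : List L)
    (α β : MvPolynomial σ ℚ) :
    κ.config s F w (α + β) = κ.config s F w α + κ.config s F w β := by
  simp only [config, extendWord_add, map_add]

theorem config_smul (s : L → σ → MvPolynomial σ ℚ) (F : σ → ℚ) (w : List L) (c : ℚ)
    (α : MvPolynomial σ ℚ) : κ.config s F w (c • α) = c * κ.config s F w α := by
  simp only [config, extendWord_smul, smul_eval]

theorem extendWord_algHom (φ : MvPolynomial σ ℚ →ₐ[ℚ] MvPolynomial τ ℚ)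
    {s : L → σ → MvPolynomial σ ℚ} {t : L → τ → MvPolynomial τ ℚ} {w : List L}
    (h : ∀ a ∈ w, ∀ i, κ.extend (t a) (φ (X i)) = φ (s a i)) (α : MvPolynomial σ ℚ) :
    κ.extendWord t w (φ α) = φ (κ.extendWord s w α) := by
  induction w generalizing α with
  | nil => rfl
  | cons a w ih =>
    rw [extendWord_cons, extendWord_cons, κ.extend_algHom φ (h a List.mem_cons_self)]
    exact ih (fun b hb => h b (List.mem_cons_of_mem a hb)) _

/-- An algebra homomorphism that is compatible with transitions and outputs preserves the series
of configurations. -/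
theorem config_algHom (φ : MvPolynomial σ ℚ →ₐ[ℚ] MvPolynomial τ ℚ)
    {s : L → σ → MvPolynomial σ ℚ} {t : L → τ → MvPolynomial τ ℚ} {F : σ → ℚ} {G : τ → ℚ}
    {w : List L} (h : ∀ a ∈ w, ∀ i, κ.extend (t a) (φ (X i)) = φ (s a i))
    (hF : ∀ i, eval G (φ (X i)) = F i) (α : MvPolynomial σ ℚ) :
    κ.config t G w (φ α) = κ.config s F w α := by
  have e : ((aeval G).comp φ : MvPolynomial σ ℚ →ₐ[ℚ] ℚ) = aeval F :=
    MvPolynomial.algHom_ext fun i => by simpa [coe_aeval_eq_eval] using hF i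
  rw [config, config, κ.extendWord_algHom φ h, ← coe_aeval_eq_eval, ← coe_aeval_eq_eval, ← e]
  rfl

/-- If the outputs of an extension of `r` agree on the variables with those of an extension of
`s`, then they agree on all polynomials. -/
theorem eval_extend_eq (φ : MvPolynomial σ ℚ →ₐ[ℚ] MvPolynomial τ ℚ)
    {s : σ → MvPolynomial σ ℚ} {r : τ → MvPolynomial τ ℚ} {F : σ → ℚ} {G : τ → ℚ}
    (hF : ∀ i, eval G (φ (X i)) = F i)
    (h : ∀ i, eval G (κ.extend r (φ (X i))) = eval F (s i)) (α : MvPolynomial σ ℚ) :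
    eval G (κ.extend r (φ α)) = eval F (κ.extend s α) := by
  have e (α) : eval G (φ α) = eval F α := by
    have := κ.config_algHom (L := Empty) (w := []) φ (s := nofun) (t := nofun) nofun hF α
    simpa only [config_nil] using this
  induction α using MvPolynomial.induction_on with
  | C c =>
    have hc : φ (C c) = C c := φ.commutes c
    simp only [hc, extend_C, map_nsmul, eval_C]
  | add p q hp hq => simp only [map_add, hp, hq]
  | mul_X p i hp =>
    simp only [map_mul, extend_mul, map_add, map_nsmul, hp, h, e, extend_X, eval_X]

end ProductKind

/-! ### Arithmetic on presentations -/

namespace RatCode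

/-- Addition of presented rational numbers. The last component of a presentation is the denominator
minus one, whence its form here and in the product. -/
def add (p q : RatCode) : RatCode :=
  (p.1 * (q.2.2 + 1) + q.1 * (p.2.2 + 1), p.2.1 * (q.2.2 + 1) + q.2.1 * (p.2.2 + 1),
    p.2.2 * q.2.2 + p.2.2 + q.2.2)

/-- Multiplication of presented rational numbers. -/
def mul (p q : RatCode) : RatCode :=
  (p.1 * q.1 + p.2.1 * q.2.1, p.1 * q.2.1 + p.2.1 * q.1, p.2.2 * q.2.2 + p.2.2 + q.2.2)

/-- The presentation of a natural number. -/
def ofNat (n : ℕ) : RatCode := (n, 0, 0)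

/-- The presentation of `-1`. -/
def negOne : RatCode := (0, 1, 0)

theorem val_add (p q : RatCode) : (add p q).val = p.val + q.val := by
  have h1 : (p.2.2 : ℚ) + 1 ≠ 0 := by positivity
  have h2 : (q.2.2 : ℚ) + 1 ≠ 0 := by positivity
  have h3 : ((p.2.2 * q.2.2 + p.2.2 + q.2.2 : ℕ) : ℚ) + 1 = (p.2.2 + 1) * (q.2.2 + 1) := by
    push_cast; ring
  simp only [val, add, h3]
  push_cast
  field_simp
  ring

theorem val_mul (p q : RatCode) : (mul p q).val = p.val * q.val := by
  have h1 : (p.2.2 : ℚ) + 1 ≠ 0 := by positivity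
  have h2 : (q.2.2 : ℚ) + 1 ≠ 0 := by positivity
  have h3 : ((p.2.2 * q.2.2 + p.2.2 + q.2.2 : ℕ) : ℚ) + 1 = (p.2.2 + 1) * (q.2.2 + 1) := by
    push_cast; ring
  simp only [val, mul, h3]
  push_cast
  field_simp
  ring

@[simp] theorem val_ofNat (n : ℕ) : (ofNat n).val = n := by simp [val, ofNat]

@[simp] theorem val_negOne : negOne.val = -1 := by simp [val, negOne]

@[simp] theorem val_zero : RatCode.val (0, 0, 0) = 0 := by simp [val]

theorem val_eq_zero_iff (p : RatCode) : p.val = 0 ↔ p.1 = p.2.1 := by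
  have h1 : (p.2.2 : ℚ) + 1 ≠ 0 := by positivity
  simp [val, h1, sub_eq_zero]

theorem primrec_add : Primrec₂ add := by
  have h1 : Primrec fun x : RatCode × RatCode => x.1.2.2 :=
    Primrec.snd.comp (Primrec.snd.comp Primrec.fst)
  have h2 : Primrec fun x : RatCode × RatCode => x.2.2.2 :=
    Primrec.snd.comp (Primrec.snd.comp Primrec.snd)
  have h3 : Primrec fun x : RatCode × RatCode => x.1.2.1 :=
    Primrec.fst.comp (Primrec.snd.comp Primrec.fst)
  have h4 : Primrec fun x : RatCode × RatCode => x.2.2.1 :=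
    Primrec.fst.comp (Primrec.snd.comp Primrec.snd)
  have h5 : Primrec fun x : RatCode × RatCode => x.1.1 := Primrec.fst.comp Primrec.fst
  have h6 : Primrec fun x : RatCode × RatCode => x.2.1 := Primrec.fst.comp Primrec.snd
  have s1 := Primrec.succ.comp h1
  have s2 := Primrec.succ.comp h2
  exact (Primrec.nat_add.comp (Primrec.nat_mul.comp h5 s2) (Primrec.nat_mul.comp h6 s1)).pair
    ((Primrec.nat_add.comp (Primrec.nat_mul.comp h3 s2) (Primrec.nat_mul.comp h4 s1)).pair
      (Primrec.nat_add.comp (Primrec.nat_add.comp (Primrec.nat_mul.comp h1 h2) h1) h2))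

theorem primrec_mul : Primrec₂ mul := by
  have h1 : Primrec fun x : RatCode × RatCode => x.1.2.2 :=
    Primrec.snd.comp (Primrec.snd.comp Primrec.fst)
  have h2 : Primrec fun x : RatCode × RatCode => x.2.2.2 :=
    Primrec.snd.comp (Primrec.snd.comp Primrec.snd)
  have h3 : Primrec fun x : RatCode × RatCode => x.1.2.1 :=
    Primrec.fst.comp (Primrec.snd.comp Primrec.fst)
  have h4 : Primrec fun x : RatCode × RatCode => x.2.2.1 :=
    Primrec.fst.comp (Primrec.snd.comp Primrec.snd)
  have h5 : Primrec fun x : RatCode × RatCode => x.1.1 := Primrec.fst.comp Primrec.fst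
  have h6 : Primrec fun x : RatCode × RatCode => x.2.1 := Primrec.fst.comp Primrec.snd
  exact (Primrec.nat_add.comp (Primrec.nat_mul.comp h5 h6) (Primrec.nat_mul.comp h3 h4)).pair
    ((Primrec.nat_add.comp (Primrec.nat_mul.comp h5 h4) (Primrec.nat_mul.comp h3 h6)).pair
      (Primrec.nat_add.comp (Primrec.nat_add.comp (Primrec.nat_mul.comp h1 h2) h1) h2))

theorem primrecPred_val_eq_zero : PrimrecPred fun p : RatCode => p.val = 0 :=
  (Primrec.eq.comp Primrec.fst (Primrec.fst.comp Primrec.snd)).of_eq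
    fun p => (val_eq_zero_iff p).symm

end RatCode

namespace PolyCode

/-- The polynomial presented by a list of terms, in variables indexed by all natural numbers. -/
noncomputable def natPoly (p : PolyCode) : MvPolynomial ℕ ℚ :=
  (p.map fun t => C (RatCode.val t.1) * (t.2.map X).prod).sum

/-- The projection of polynomials in variables indexed by `ℕ` to polynomials in the first `n`
variables, which sends the other variables to `0`. -/
noncomputable def truncate (n : ℕ) : MvPolynomial ℕ ℚ →ₐ[ℚ] MvPolynomial (Fin n) ℚ :=
  aeval fun i => if h : i < n then X ⟨i, h⟩ else 0

theorem toPoly_eq_truncate (n : ℕ) (p : PolyCode) : p.toPoly n = truncate n p.natPoly := by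
  have h (l : List ℕ) : truncate n (l.map X).prod =
      (l.map fun i => if h : i < n then (X ⟨i, h⟩ : MvPolynomial (Fin n) ℚ) else 0).prod := by
    rw [map_list_prod, List.map_map]
    congr 1
    apply List.map_congr_left
    intro i _
    simp [truncate]
  have hC (c : ℚ) : truncate n (C c) = C c := (truncate n).commutes c
  simp only [toPoly, natPoly, map_list_sum, List.map_map]
  congr 1
  apply List.map_congr_left
  intro t _
  simp only [Function.comp, map_mul, h, hC]

@[simp] theorem natPoly_nil : natPoly [] = 0 := rfl

@[simp] theorem natPoly_cons (t : RatCode × List ℕ) (p : PolyCode) :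
    natPoly (t :: p) = C t.1.val * (t.2.map X).prod + natPoly p := by
  simp [natPoly]

@[simp] theorem natPoly_append (p q : PolyCode) : natPoly (p ++ q) = natPoly p + natPoly q := by
  simp [natPoly]

/-- The presentation of a constant. -/
def const (c : RatCode) : PolyCode := [(c, [])]

/-- The presentation of a variable. -/
def var (i : ℕ) : PolyCode := [(RatCode.ofNat 1, [i])]

@[simp] theorem natPoly_const (c : RatCode) : natPoly (const c) = C c.val := by simp [const]

@[simp] theorem natPoly_var (i : ℕ) : natPoly (var i) = X i := by simp [var]

/-- Multiplication of a presented polynomial by a term. -/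
def mulTerm (t : RatCode × List ℕ) (p : PolyCode) : PolyCode :=
  p.map fun u => (t.1.mul u.1, t.2 ++ u.2)

theorem natPoly_mulTerm (t : RatCode × List ℕ) (p : PolyCode) :
    natPoly (mulTerm t p) = C t.1.val * (t.2.map X).prod * natPoly p := by
  induction p with
  | nil => simp [mulTerm]
  | cons u p ih =>
    have : mulTerm t (u :: p) = (t.1.mul u.1, t.2 ++ u.2) :: mulTerm t p := rfl
    simp only [this, natPoly_cons, ih, RatCode.val_mul, List.map_append, List.prod_append, C_mul]
    ring

/-- Scalar multiplication of presented polynomials. -/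
def scale (c : RatCode) (p : PolyCode) : PolyCode := mulTerm (c, []) p

@[simp] theorem natPoly_scale (c : RatCode) (p : PolyCode) :
    natPoly (scale c p) = C c.val * natPoly p := by
  simp [scale, natPoly_mulTerm]

/-- Multiplication of presented polynomials. -/
def mul (p q : PolyCode) : PolyCode := p.flatMap fun t => mulTerm t q

@[simp] theorem natPoly_mul (p q : PolyCode) : natPoly (mul p q) = natPoly p * natPoly q := by
  induction p with
  | nil => simp [mul]
  | cons t p ih =>
    have : mul (t :: p) q = mulTerm t q ++ mul p q := rfl
    rw [this, natPoly_append, ih, natPoly_mulTerm, natPoly_cons]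
    ring

/-- Renaming of the variables of a presented polynomial. -/
def renameVars (g : ℕ → ℕ) (p : PolyCode) : PolyCode := p.map fun t => (t.1, t.2.map g)

@[simp] theorem natPoly_renameVars (g : ℕ → ℕ) (p : PolyCode) :
    natPoly (renameVars g p) = rename g (natPoly p) := by
  induction p with
  | nil => simp [renameVars]
  | cons t p ih =>
    have : renameVars g (t :: p) = (t.1, t.2.map g) :: renameVars g p := rfl
    rw [this, natPoly_cons, ih, natPoly_cons]
    simp [map_list_prod, Function.comp_def]

/-- A monomial, given by the list of its variables, together with its image under the extension
of `s` that belongs to the product `κ`. Both are computed by the same recursion, because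
the product rule for the image involves the monomial itself. -/
def extendMonomial (κ : ProductKind) (s : ℕ → PolyCode) (l : List ℕ) : PolyCode × PolyCode :=
  l.foldr (fun i P => (mul (var i) P.1,
    scale (.ofNat κ.diagCoeff) (mul (s i) P.2) ++
      scale (.ofNat κ.sideCoeff) (mul (s i) P.1 ++ mul (var i) P.2)))
    (const (.ofNat 1), const (.ofNat κ.oneCoeff))

theorem natPoly_extendMonomial (κ : ProductKind) (s : ℕ → PolyCode) (l : List ℕ) :
    natPoly (extendMonomial κ s l).1 = (l.map X).prod ∧
    natPoly (extendMonomial κ s l).2 =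
      κ.extend (fun i => natPoly (s i)) (l.map X).prod := by
  induction l with
  | nil =>
    have := κ.extend_C (fun i => natPoly (s i)) 1
    rw [C_1] at this
    simp [extendMonomial, this]
  | cons i l ih =>
    have : extendMonomial κ s (i :: l) = (mul (var i) (extendMonomial κ s l).1,
      scale (.ofNat κ.diagCoeff) (mul (s i) (extendMonomial κ s l).2) ++
        scale (.ofNat κ.sideCoeff) (mul (s i) (extendMonomial κ s l).1
          ++ mul (var i) (extendMonomial κ s l).2)) := rfl
    rw [this]
    simp only [natPoly_mul, natPoly_append, natPoly_scale, natPoly_var, ih, RatCode.val_ofNat,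
      List.map_cons, List.prod_cons, ProductKind.extend_mul, ProductKind.extend_X, map_natCast,
      nsmul_eq_mul, and_self]

/-- The extension of a table `s` of polynomials that belongs to the product `κ`, computed on
presentations. -/
def extend (κ : ProductKind) (s : ℕ → PolyCode) (p : PolyCode) : PolyCode :=
  p.flatMap fun t => scale t.1 (extendMonomial κ s t.2).2

@[simp] theorem natPoly_extend (κ : ProductKind) (s : ℕ → PolyCode) (p : PolyCode) :
    natPoly (extend κ s p) = κ.extend (fun i => natPoly (s i)) (natPoly p) := by
  induction p with
  | nil => simp [extend]
  | cons t p ih =>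
    have : extend κ s (t :: p) = scale t.1 (extendMonomial κ s t.2).2 ++ extend κ s p := rfl
    rw [this, natPoly_append, ih, natPoly_scale, (natPoly_extendMonomial κ s t.2).2, natPoly_cons,
      map_add, ProductKind.extend_C_mul]

/-- The value of a presented polynomial. -/
def evalCode (v : ℕ → RatCode) (p : PolyCode) : RatCode :=
  p.foldr (fun t c => (t.1.mul (t.2.foldr (fun i c => (v i).mul c) (.ofNat 1))).add c) (.ofNat 0)

@[simp] theorem val_evalCode (v : ℕ → RatCode) (p : PolyCode) :
    (evalCode v p).val = eval (fun i => (v i).val) (natPoly p) := by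
  have h (l : List ℕ) : (l.foldr (fun i c => (v i).mul c) (RatCode.ofNat 1)).val
      = eval (fun i => (v i).val) (l.map X).prod := by
    induction l with
    | nil => simp
    | cons i l ih => simp [RatCode.val_mul, ih]
  induction p with
  | nil => simp [evalCode]
  | cons t p ih =>
    have : evalCode v (t :: p) =
      (t.1.mul (t.2.foldr (fun i c => (v i).mul c) (.ofNat 1))).add (evalCode v p) := rfl
    rw [this, RatCode.val_add, RatCode.val_mul, h, ih]
    simp

/-! ### Computability of the arithmetic -/

variable {α : Type} [Primcodable α]

theorem primrec_var : Primrec var :=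
  Primrec.list_cons.comp (Primrec.pair (Primrec.const _)
    (Primrec.list_cons.comp Primrec.id (Primrec.const []))) (Primrec.const [])

theorem primrec_mulTerm : Primrec₂ mulTerm := by
  refine Primrec.list_map Primrec.snd ?_
  exact (RatCode.primrec_mul.comp (Primrec.fst.comp (Primrec.fst.comp Primrec.fst))
    (Primrec.fst.comp Primrec.snd)).pair
    (Primrec.list_append.comp (Primrec.snd.comp (Primrec.fst.comp Primrec.fst))
    (Primrec.snd.comp Primrec.snd))

theorem primrec_scale : Primrec₂ scale :=
  primrec_mulTerm.comp (Primrec.fst.pair (Primrec.const [])) Primrec.snd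

theorem primrec_mul : Primrec₂ mul :=
  Primrec.list_flatMap Primrec.fst
    (primrec_mulTerm.comp Primrec.snd (Primrec.snd.comp Primrec.fst))

theorem primrec_renameVars {g : ℕ → ℕ} (hg : Primrec g) : Primrec (renameVars g) :=
  Primrec.list_map Primrec.id
    ((Primrec.fst.comp Primrec.snd).pair
      (Primrec.list_map (Primrec.snd.comp Primrec.snd) (hg.comp Primrec.snd).to₂)).to₂

theorem primrec_extend (κ : ProductKind) {s : α → ℕ → PolyCode} {p : α → PolyCode}
    (hs : Primrec₂ s) (hp : Primrec p) : Primrec fun a => extend κ (s a) (p a) := by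
  have hstep : Primrec fun x : (α × (RatCode × List ℕ)) × (ℕ × (PolyCode × PolyCode)) =>
      ((mul (var x.2.1) x.2.2.1,
        scale (.ofNat κ.diagCoeff) (mul (s x.1.1 x.2.1) x.2.2.2) ++
        scale (.ofNat κ.sideCoeff)
          (mul (s x.1.1 x.2.1) x.2.2.1 ++ mul (var x.2.1) x.2.2.2)) : PolyCode × PolyCode) := by
    have hi : Primrec fun x : (α × (RatCode × List ℕ)) × (ℕ × (PolyCode × PolyCode)) => x.2.1 :=
      Primrec.fst.comp Primrec.snd
    have hP : Primrec fun x : (α × (RatCode × List ℕ)) × (ℕ × (PolyCode × PolyCode)) => x.2.2.1 :=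
      Primrec.fst.comp (Primrec.snd.comp Primrec.snd)
    have hQ : Primrec fun x : (α × (RatCode × List ℕ)) × (ℕ × (PolyCode × PolyCode)) => x.2.2.2 :=
      Primrec.snd.comp (Primrec.snd.comp Primrec.snd)
    have hv := primrec_var.comp hi
    have hsi := hs.comp (Primrec.fst.comp Primrec.fst) hi
    exact (primrec_mul.comp hv hP).pair (Primrec.list_append.comp
      (primrec_scale.comp (Primrec.const _) (primrec_mul.comp hsi hQ))
      (primrec_scale.comp (Primrec.const _)
        (Primrec.list_append.comp (primrec_mul.comp hsi hP) (primrec_mul.comp hv hQ))))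
  have hmono : Primrec fun x : α × (RatCode × List ℕ) => extendMonomial κ (s x.1) x.2.2 :=
    Primrec.list_foldr (Primrec.snd.comp Primrec.snd) (Primrec.const _) hstep.to₂
  exact Primrec.list_flatMap hp
    (primrec_scale.comp (Primrec.fst.comp Primrec.snd) (Primrec.snd.comp hmono)).to₂

theorem primrec_evalCode {v : α → ℕ → RatCode} {p : α → PolyCode}
    (hv : Primrec₂ v) (hp : Primrec p) : Primrec fun a => evalCode (v a) (p a) := by
  have hmono : Primrec fun x : α × (RatCode × List ℕ) × RatCode =>
      x.2.1.2.foldr (fun i c => (v x.1 i).mul c) (RatCode.ofNat 1) :=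
    Primrec.list_foldr (Primrec.snd.comp (Primrec.fst.comp Primrec.snd)) (Primrec.const _)
      (RatCode.primrec_mul.comp
        (hv.comp (Primrec.fst.comp Primrec.fst) (Primrec.fst.comp Primrec.snd))
        (Primrec.snd.comp Primrec.snd)).to₂
  exact Primrec.list_foldr hp (Primrec.const _)
    (RatCode.primrec_add.comp (RatCode.primrec_mul.comp
      (Primrec.fst.comp (Primrec.fst.comp Primrec.snd)) hmono)
      (Primrec.snd.comp Primrec.snd)).to₂

/-! ### The zero test for presented polynomials -/

/-- The coefficient of the monomial whose list of variables is `l`. -/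
def coeffCode (p : PolyCode) (l : List ℕ) : RatCode :=
  p.foldr (fun t c => if t.2.Perm l then t.1.add c else c) (.ofNat 0)

/-- All coefficients of the presented polynomial vanish. -/
def IsZero (p : PolyCode) : Prop := ∀ t ∈ p, (coeffCode p t.2).val = 0

theorem prod_map_X_eq_monomial (l : List ℕ) :
    (l.map X).prod = (monomial (Multiset.toFinsupp (l : Multiset ℕ)) 1 : MvPolynomial ℕ ℚ) := by
  induction l with
  | nil => simp
  | cons i l ih =>
    rw [List.map_cons, List.prod_cons, ih, ← Multiset.cons_coe, ← Multiset.singleton_add,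
      map_add, Multiset.toFinsupp_singleton, X, monomial_mul, one_mul]

theorem coeff_natPoly (p : PolyCode) (m : ℕ →₀ ℕ) :
    coeff m (natPoly p) =
      (p.map fun t => if Multiset.toFinsupp (t.2 : Multiset ℕ) = m then t.1.val else 0).sum := by
  classical
  induction p with
  | nil => simp
  | cons t p ih =>
    simp [natPoly_cons, ih, prod_map_X_eq_monomial, coeff_C_mul, coeff_monomial]

theorem val_coeffCode (p : PolyCode) (l : List ℕ) :
    (coeffCode p l).val = coeff (Multiset.toFinsupp (l : Multiset ℕ)) (natPoly p) := by
  rw [coeff_natPoly]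
  induction p with
  | nil => simp [coeffCode]
  | cons t p ih =>
    have : coeffCode (t :: p) l =
      if t.2.Perm l then t.1.add (coeffCode p l) else coeffCode p l := rfl
    rw [this, List.map_cons, List.sum_cons, ← ih]
    simp only [EmbeddingLike.apply_eq_iff_eq, Multiset.coe_eq_coe]
    split_ifs <;> simp [RatCode.val_add]

theorem isZero_iff (p : PolyCode) : p.IsZero ↔ natPoly p = 0 := by
  constructor
  · intro h
    ext m
    rw [coeff_zero]
    by_cases hm : ∃ t ∈ p, Multiset.toFinsupp (t.2 : Multiset ℕ) = m
    · obtain ⟨t, ht, rfl⟩ := hm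
      rw [← val_coeffCode]
      exact h t ht
    · push Not at hm
      rw [coeff_natPoly]
      apply List.sum_eq_zero
      simp only [List.mem_map, forall_exists_index, and_imp]
      rintro _ t ht rfl
      rw [if_neg (hm t ht)]
  · intro h t _
    rw [val_coeffCode, h, coeff_zero]

/-- Removal of the terms with a variable that is not among the first `n`. -/
def restrict (n : ℕ) (p : PolyCode) : PolyCode := p.filter fun t => ∀ i ∈ t.2, i < n

theorem natPoly_restrict (n : ℕ) (p : PolyCode) :
    natPoly (restrict n p) = rename Fin.val (p.toPoly n) := by
  rw [toPoly_eq_truncate]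
  induction p with
  | nil => simp [restrict]
  | cons t p ih =>
    have hC : truncate n (C t.1.val) = C t.1.val := (truncate n).commutes _
    have hX (i : ℕ) : rename Fin.val (truncate n (X i))
        = if i < n then (X i : MvPolynomial ℕ ℚ) else 0 := by
      simp only [truncate, aeval_X]
      split_ifs <;> simp
    rw [natPoly_cons, map_add, map_add, ← ih, map_mul, hC, map_mul, rename_C, map_list_prod,
      map_list_prod, List.map_map, List.map_map]
    by_cases h : ∀ i ∈ t.2, i < n
    · have : restrict n (t :: p) = t :: restrict n p := List.filter_cons_of_pos (by simpa using h)
      rw [this, natPoly_cons]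
      congr 3
      apply List.map_congr_left
      intro i hi
      simp [hX, h i hi]
    · have : restrict n (t :: p) = restrict n p := List.filter_cons_of_neg (by simpa using h)
      push Not at h
      obtain ⟨i, hi, hin⟩ := h
      rw [this, List.prod_eq_zero, mul_zero, zero_add]
      exact List.mem_map.2 ⟨i, hi, by simp [hX, hin]⟩

/-- The zero test for polynomials in `n` variables: terms with other variables are read as `0`. -/
theorem isZero_restrict_iff (n : ℕ) (p : PolyCode) : (restrict n p).IsZero ↔ p.toPoly n = 0 := by
  rw [isZero_iff, natPoly_restrict]
  exact map_eq_zero_iff _ (rename_injective _ Fin.val_injective)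

end PolyCode

theorem PrimrecRel.forall_mem_of_primrec {α β : Type} [Primcodable α] [Primcodable β]
    {f : α → List β} {R : α → β → Prop} (hf : Primrec f) (hR : PrimrecRel R) :
    PrimrecPred fun a => ∀ b ∈ f a, R a b :=
  hR.swap.forall_mem_list.comp hf Primrec.id

theorem primrecRel_perm : PrimrecRel fun l l' : List ℕ => l.Perm l' := by
  have hcount : Primrec₂ fun (l : List ℕ) (i : ℕ) => l.count i :=
    (Primrec.list_length.comp (Primrec.eq (α := ℕ)).listFilter).of_eq fun x => by
      change (x.1.filter fun i => decide (i = x.2)).length = x.1.count x.2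
      rw [List.count_eq_length_filter]
      rfl
  -- only the multiplicities of the entries that occur have to be compared
  have h : PrimrecPred fun x : List ℕ × List ℕ => ∀ i ∈ x.1 ++ x.2, x.1.count i = x.2.count i :=
    PrimrecRel.forall_mem_of_primrec Primrec.list_append
      (Primrec.eq.comp (hcount.comp (Primrec.fst.comp Primrec.fst) Primrec.snd)
        (hcount.comp (Primrec.snd.comp Primrec.fst) Primrec.snd))
  refine h.of_eq fun x => ?_
  refine Iff.trans ?_ List.perm_iff_count.symm
  refine ⟨fun h i => ?_, fun h i _ => h i⟩
  by_cases hi : i ∈ x.1 ++ x.2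
  · exact h i hi
  · rw [List.mem_append, not_or] at hi
    rw [List.count_eq_zero_of_not_mem hi.1, List.count_eq_zero_of_not_mem hi.2]

namespace PolyCode

theorem primrec_coeffCode : Primrec₂ coeffCode := by
  have hstep : Primrec fun x : (PolyCode × List ℕ) × (RatCode × List ℕ) × RatCode =>
      if x.2.1.2.Perm x.1.2 then x.2.1.1.add x.2.2 else x.2.2 :=
    Primrec.ite (primrecRel_perm.comp (Primrec.snd.comp (Primrec.fst.comp Primrec.snd))
      (Primrec.snd.comp Primrec.fst))
    (RatCode.primrec_add.comp (Primrec.fst.comp (Primrec.fst.comp Primrec.snd))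
      (Primrec.snd.comp Primrec.snd))
    (Primrec.snd.comp Primrec.snd)
  exact Primrec.list_foldr Primrec.fst (Primrec.const _) hstep.to₂

theorem primrecPred_isZero : PrimrecPred IsZero :=
  PrimrecRel.forall_mem_of_primrec Primrec.id
    (RatCode.primrecPred_val_eq_zero.comp
      (primrec_coeffCode.comp Primrec.fst (Primrec.snd.comp Primrec.snd)))

theorem primrec_restrict : Primrec₂ restrict := by
  have h : PrimrecRel fun (t : RatCode × List ℕ) (n : ℕ) => ∀ i ∈ t.2, i < n :=
    PrimrecRel.forall_mem_of_primrec (Primrec.snd.comp Primrec.fst)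
      (Primrec.nat_lt.comp Primrec.snd (Primrec.snd.comp Primrec.fst))
  exact h.listFilter.swap

theorem primrecRel_toPoly_eq_zero : PrimrecRel fun (n : ℕ) (p : PolyCode) => p.toPoly n = 0 :=
  (primrecPred_isZero.comp primrec_restrict).of_eq fun x => isZero_restrict_iff x.1 x.2

end PolyCode

/-! ### Automata given by tables -/

/-- The tables of the output function and of the transition function. -/
abbrev AutomatonTable : Type := List RatCode × List (List PolyCode)

namespace AutomatonTable

/-- The output of the `i`-th variable in an automaton with `n` variables; the variables with
an index of `n` or more have output `0`. -/
def out (n : ℕ) (T : AutomatonTable) (i : ℕ) : RatCode :=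
  if i < n then T.1.getD i (0, 0, 0) else (0, 0, 0)

/-- The transition of the `i`-th variable by the letter `a` in an automaton with `n` variables;
the variables with an index of `n` or more have transition `0`. -/
def step (n : ℕ) (T : AutomatonTable) (a i : ℕ) : PolyCode :=
  if i < n then (T.2.getD a []).getD i [] else []

theorem out_of_le {n i : ℕ} (T : AutomatonTable) (h : n ≤ i) : T.out n i = (0, 0, 0) :=
  if_neg (by omega)

theorem step_of_le {n i : ℕ} (T : AutomatonTable) (a : ℕ) (h : n ≤ i) : T.step n a i = [] :=
  if_neg (by omega)

/-- The series of a configuration of the automaton with `n` variables given by a table, whose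
polynomials are read in variables indexed by all natural numbers. -/
noncomputable def config (κ : ProductKind) (n : ℕ) (T : AutomatonTable) (w : List ℕ)
    (α : MvPolynomial ℕ ℚ) : ℚ :=
  κ.config (fun a i => (T.step n a i).natPoly) (fun i => (T.out n i).val) w α

/-- The transition function of a table, with polynomials in `n` variables. -/
noncomputable def finStep (n : ℕ) (T : AutomatonTable) (a : ℕ) (i : Fin n) :
    MvPolynomial (Fin n) ℚ :=
  ((T.2.getD a []).getD i []).toPoly n

/-- The output function of a table, for `n` variables. -/
def finOut (n : ℕ) (T : AutomatonTable) (i : Fin n) : ℚ := (T.1.getD i (0, 0, 0)).val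

theorem extend_truncate_X (κ : ProductKind) (n : ℕ) (T : AutomatonTable) (a i : ℕ) :
    κ.extend (T.finStep n a) (PolyCode.truncate n (X i)) =
      PolyCode.truncate n (T.step n a i).natPoly := by
  rw [PolyCode.truncate, aeval_X]
  by_cases h : i < n
  · rw [dif_pos h, ProductKind.extend_X, finStep, step, if_pos h, PolyCode.toPoly_eq_truncate,
      PolyCode.truncate]
  · rw [dif_neg h, map_zero, step, if_neg h, PolyCode.natPoly_nil, map_zero]

theorem eval_truncate_X (n : ℕ) (T : AutomatonTable) (i : ℕ) :
    eval (T.finOut n) (PolyCode.truncate n (X i)) = (T.out n i).val := by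
  rw [PolyCode.truncate, aeval_X]
  by_cases h : i < n
  · rw [dif_pos h, eval_X, finOut, out, if_pos h]
  · rw [dif_neg h, map_zero, out, if_neg h, RatCode.val_zero]

/-- Since the variables outside of the table have output and transitions `0`, substituting `0` for
them does not change the series of a configuration. -/
theorem config_truncate (κ : ProductKind) (n : ℕ) (T : AutomatonTable) (w : List ℕ)
    (α : MvPolynomial ℕ ℚ) :
    κ.config (T.finStep n) (T.finOut n) w (PolyCode.truncate n α) = T.config κ n w α :=
  κ.config_algHom _ (fun a _ i => extend_truncate_X κ n T a i) (eval_truncate_X n T) α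

theorem toPoly_extend (κ : ProductKind) (n : ℕ) (T : AutomatonTable) (a : ℕ) (p : PolyCode) :
    (p.extend κ (T.step n a)).toPoly n = κ.extend (T.finStep n a) (p.toPoly n) := by
  rw [PolyCode.toPoly_eq_truncate, PolyCode.toPoly_eq_truncate, PolyCode.natPoly_extend]
  exact (κ.extend_algHom _ (extend_truncate_X κ n T a) _).symm

theorem val_evalCode_out (n : ℕ) (T : AutomatonTable) (p : PolyCode) :
    (p.evalCode (T.out n)).val = eval (T.finOut n) (p.toPoly n) := by
  rw [PolyCode.val_evalCode, PolyCode.toPoly_eq_truncate]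
  exact (config_truncate .hadamard n T [] p.natPoly).symm

/-- The table of an automaton with `n` variables over the alphabet `{0, …, d - 1}`. -/
def build (d n : ℕ) (out : ℕ → RatCode) (step : ℕ → ℕ → PolyCode) : AutomatonTable :=
  ((List.range n).map out, (List.range d).map fun a => (List.range n).map (step a))

theorem out_build {n : ℕ} (d : ℕ) {o : ℕ → RatCode} (s : ℕ → ℕ → PolyCode)
    (ho : ∀ i, n ≤ i → o i = (0, 0, 0)) (i : ℕ) : (build d n o s).out n i = o i := by
  by_cases h : i < n
  · simp [out, build, h, List.getD_eq_getElem?_getD]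
  · rw [out_of_le _ (by omega), ho i (by omega)]

theorem step_build {d n a : ℕ} (ha : a < d) (o : ℕ → RatCode) {s : ℕ → ℕ → PolyCode}
    (hs : ∀ i, n ≤ i → s a i = []) (i : ℕ) : (build d n o s).step n a i = s a i := by
  by_cases h : i < n
  · simp [step, build, h, ha, List.getD_eq_getElem?_getD]
  · rw [step_of_le _ _ (by omega), hs i (by omega)]

variable {α : Type} [Primcodable α]

theorem primrec_out {n : α → ℕ} {T : α → AutomatonTable} {i : α → ℕ}
    (hn : Primrec n) (hT : Primrec T) (hi : Primrec i) :
    Primrec fun x => (T x).out (n x) (i x) :=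
  Primrec.ite (Primrec.nat_lt.comp hi hn)
    ((Primrec.list_getD _).comp (Primrec.fst.comp hT) hi) (Primrec.const _)

theorem primrec_step {n : α → ℕ} {T : α → AutomatonTable} {a i : α → ℕ}
    (hn : Primrec n) (hT : Primrec T) (ha : Primrec a) (hi : Primrec i) :
    Primrec fun x => (T x).step (n x) (a x) (i x) :=
  Primrec.ite (Primrec.nat_lt.comp hi hn)
    ((Primrec.list_getD _).comp ((Primrec.list_getD _).comp (Primrec.snd.comp hT) ha) hi)
    (Primrec.const _)

theorem primrec_build {d n : α → ℕ} {o : α → ℕ → RatCode} {s : α → ℕ → ℕ → PolyCode}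
    (hd : Primrec d) (hn : Primrec n) (ho : Primrec₂ o)
    (hs : Primrec fun x : (α × ℕ) × ℕ => s x.1.1 x.1.2 x.2) :
    Primrec fun x => build (d x) (n x) (o x) (s x) :=
  (Primrec.list_map (Primrec.list_range.comp hn) ho).pair
    (Primrec.list_map (Primrec.list_range.comp hd)
      (Primrec.list_map (Primrec.list_range.comp (hn.comp Primrec.fst)) hs.to₂).to₂)

end AutomatonTable

theorem ProductAutomatonCode.series_eq_finConfig (κ : ProductKind) (d : ℕ)
    (c : ProductAutomatonCode) (w : List (Fin d)) :
    ProductAutomatonCode.series κ d c w =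
      κ.config (AutomatonTable.finStep (c.1 + 1) c.2) (AutomatonTable.finOut (c.1 + 1) c.2)
        (w.map Fin.val) (X 0) := by
  rw [ProductKind.config_map]
  rfl

theorem ProductAutomatonCode.series_eq_config (κ : ProductKind) (d : ℕ)
    (c : ProductAutomatonCode) (w : List (Fin d)) :
    ProductAutomatonCode.series κ d c w =
      AutomatonTable.config κ (c.1 + 1) c.2 (w.map Fin.val) (X 0) := by
  have : PolyCode.truncate (c.1 + 1) (X 0) = X 0 := by simp [PolyCode.truncate]
  rw [← AutomatonTable.config_truncate, this, series_eq_finConfig]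

theorem List.map_val_lt {d : ℕ} (w : List (Fin d)) : ∀ a ∈ w.map Fin.val, a < d := by
  simp

namespace AutomatonTable

/-! ### The automaton of a configuration -/

/-- The table obtained by adding a new distinguished nonterminal that behaves like
the configuration `p`; the indices of the old nonterminals are increased by one. -/
def pointedTable (κ : ProductKind) (d n : ℕ) (T : AutomatonTable) (p : PolyCode) :
    AutomatonTable :=
  build d (n + 1)
    (fun i => if i = 0 then p.evalCode (T.out n) else T.out n (i - 1))
    (fun a i => (if i = 0 then p.extend κ (T.step n a) else T.step n a (i - 1)).renameVars
      Nat.succ)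

/-- The automaton with the table `pointedTable`; it recognises the series of the configuration
`p`. -/
def pointed (κ : ProductKind) (d n : ℕ) (T : AutomatonTable) (p : PolyCode) :
    ProductAutomatonCode :=
  (n, pointedTable κ d n T p)

theorem series_pointed (κ : ProductKind) (d n : ℕ) (T : AutomatonTable) (p : PolyCode)
    (w : List (Fin d)) :
    ProductAutomatonCode.series κ d (pointed κ d n T p) w =
      T.config κ n (w.map Fin.val) p.natPoly := by
  rw [ProductAutomatonCode.series_eq_config]
  have hw := w.map_val_lt
  generalize w.map Fin.val = v at hw
  have hout : ∀ i, (pointedTable κ d n T p).out (n + 1) i =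
      if i = 0 then p.evalCode (T.out n) else T.out n (i - 1) :=
    out_build _ _ fun i hi => by rw [if_neg (by omega), out_of_le _ (by omega)]
  have hstep : ∀ a < d, ∀ i, (pointedTable κ d n T p).step (n + 1) a i =
      (if i = 0 then p.extend κ (T.step n a) else T.step n a (i - 1)).renameVars Nat.succ :=
    fun a ha => step_build ha _ fun i hi => by
      rw [if_neg (by omega), step_of_le _ _ (by omega)]; rfl
  have hφ : ∀ (v : List ℕ), (∀ a ∈ v, a < d) → ∀ α,
      (pointedTable κ d n T p).config κ (n + 1) v (rename Nat.succ α) = T.config κ n v α := by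
    intro v hv α
    apply κ.config_algHom (rename Nat.succ)
    · intro a ha i
      simp [hstep a (hv a ha)]
    · intro i
      simp [hout]
  change (pointedTable κ d n T p).config κ (n + 1) v (X 0) = _
  cases v with
  | nil => simp [config, ProductKind.config_nil, hout]
  | cons a v =>
    have hv := fun b hb => hw b (List.mem_cons_of_mem a hb)
    have h := hφ v hv (κ.extend (fun i => (T.step n a i).natPoly) p.natPoly)
    simp only [config, ProductKind.config_cons] at h ⊢
    rw [← h]
    simp [hstep a (hw a List.mem_cons_self)]

/-! ### Disjoint unions -/

/-- The disjoint union of two automata: the variables of the first one get even indices, and those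
of the second one get odd indices. -/
def union (d n₁ n₂ : ℕ) (T₁ T₂ : AutomatonTable) : AutomatonTable :=
  build d (2 * (n₁ + n₂))
    (fun i => if i % 2 = 0 then T₁.out n₁ (i / 2) else T₂.out n₂ (i / 2))
    (fun a i => if i % 2 = 0 then (T₁.step n₁ a (i / 2)).renameVars (fun j => 2 * j)
      else (T₂.step n₂ a (i / 2)).renameVars (fun j => 2 * j + 1))

theorem config_union (κ : ProductKind) {d : ℕ} (n₁ n₂ : ℕ) (T₁ T₂ : AutomatonTable) {w : List ℕ}
    (hw : ∀ a ∈ w, a < d) (α : MvPolynomial ℕ ℚ) :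
    (union d n₁ n₂ T₁ T₂).config κ (2 * (n₁ + n₂)) w (rename (fun j => 2 * j) α) =
      T₁.config κ n₁ w α ∧
    (union d n₁ n₂ T₁ T₂).config κ (2 * (n₁ + n₂)) w (rename (fun j => 2 * j + 1) α) =
      T₂.config κ n₂ w α := by
  have hout : ∀ i, (union d n₁ n₂ T₁ T₂).out (2 * (n₁ + n₂)) i =
      if i % 2 = 0 then T₁.out n₁ (i / 2) else T₂.out n₂ (i / 2) :=
    out_build _ _ fun i hi => by
      rw [out_of_le _ (by omega), out_of_le _ (by omega), ite_self]
  have hstep : ∀ a < d, ∀ i, (union d n₁ n₂ T₁ T₂).step (2 * (n₁ + n₂)) a i =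
      if i % 2 = 0 then (T₁.step n₁ a (i / 2)).renameVars (fun j => 2 * j)
      else (T₂.step n₂ a (i / 2)).renameVars (fun j => 2 * j + 1) :=
    fun a ha => step_build ha _ fun i hi => by
      rw [step_of_le _ _ (by omega), step_of_le _ _ (by omega)]; exact ite_self _
  have hodd (i : ℕ) : (2 * i + 1) / 2 = i := by omega
  constructor
  · apply κ.config_algHom (rename fun j => 2 * j)
    · intro a ha i
      simp [hstep a (hw a ha)]
    · intro i
      simp [hout]
  · apply κ.config_algHom (rename fun j => 2 * j + 1)
    · intro a ha i
      simp [hstep a (hw a ha), Nat.add_mod, hodd]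
    · intro i
      simp [hout, Nat.add_mod, hodd]

/-! ### Right derivatives -/

/-- The table of the operator `δ^R`: it maps the variable with index `2 i` to the one with index
`2 i + 1`. -/
def rightStep (i : ℕ) : PolyCode := if i % 2 = 0 then .var (i + 1) else []

/-- The automaton for right derivatives by the letter `a`: the variable with index `2 i` stands
for the `i`-th variable of the given automaton, and the one with index `2 i + 1` for its
right derivative. As `δ^R` obeys the product rule of `κ` and commutes with transitions,
the transitions of the latter are obtained by applying `δ^R` to those of the former. -/
def rightAutomaton (κ : ProductKind) (d n : ℕ) (T : AutomatonTable) (a : ℕ) : AutomatonTable :=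
  build d (2 * n)
    (fun i => if i % 2 = 0 then T.out n (i / 2) else (T.step n a (i / 2)).evalCode (T.out n))
    (fun b i => if i % 2 = 0 then (T.step n b (i / 2)).renameVars (fun j => 2 * j)
      else ((T.step n b (i / 2)).renameVars (fun j => 2 * j)).extend κ rightStep)

theorem config_rightAutomaton (κ : ProductKind) {d a : ℕ} (n : ℕ) (T : AutomatonTable)
    {w : List ℕ} (hw : ∀ b ∈ w, b < d) (i : ℕ) :
    (rightAutomaton κ d n T a).config κ (2 * n) w (X (2 * i + 1)) =
      T.config κ n (w ++ [a]) (X i) := by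
  have hout : ∀ i, (rightAutomaton κ d n T a).out (2 * n) i =
      if i % 2 = 0 then T.out n (i / 2) else (T.step n a (i / 2)).evalCode (T.out n) :=
    out_build _ _ fun i hi => by
      rw [out_of_le _ (by omega), step_of_le _ _ (by omega)]; exact ite_self _
  have hstep : ∀ b < d, ∀ i, (rightAutomaton κ d n T a).step (2 * n) b i =
      if i % 2 = 0 then (T.step n b (i / 2)).renameVars (fun j => 2 * j)
      else ((T.step n b (i / 2)).renameVars (fun j => 2 * j)).extend κ rightStep :=
    fun b hb => step_build hb _ fun i hi => by
      rw [step_of_le _ _ (by omega)]; exact ite_self _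
  have hodd (i : ℕ) : (2 * i + 1) / 2 = i := by omega
  have hR (i : ℕ) : (rightStep (2 * i)).natPoly = X (2 * i + 1) := by simp [rightStep]
  let φ : MvPolynomial ℕ ℚ →ₐ[ℚ] MvPolynomial ℕ ℚ := rename fun j => 2 * j
  let R := κ.extend fun i => (rightStep i).natPoly
  let t := fun b i => ((rightAutomaton κ d n T a).step (2 * n) b i).natPoly
  let s := fun b i => (T.step n b i).natPoly
  -- the right derivative commutes with the transitions along a word
  have hcomm : ∀ (v : List ℕ), (∀ b ∈ v, b < d) → ∀ α,
      κ.extendWord t v (R (φ α)) = R (φ (κ.extendWord s v α)) := by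
    intro v hv
    induction v with
    | nil => exact fun _ => rfl
    | cons b v ih =>
      intro α
      rw [ProductKind.extendWord_cons, ProductKind.extendWord_cons,
        ← ih (fun c hc => hv c (List.mem_cons_of_mem b hc))]
      congr 1
      have hb := hv b List.mem_cons_self
      apply κ.extend_commute φ
      · intro i
        simp [t, φ, s, hstep b hb]
      · intro i
        simp [t, φ, s, hstep b hb, hR, Nat.add_mod, hodd]
  have hX : (X (2 * i + 1) : MvPolynomial ℕ ℚ) = R (φ (X i)) := by simp [R, φ, hR]
  rw [hX, config, config, ProductKind.config_concat, ProductKind.config, hcomm w hw]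
  apply κ.eval_extend_eq φ
  · intro i
    simp [φ, hout]
  · intro i
    simp [φ, hout, hR, Nat.add_mod, hodd]

/-! ### Computability of the constructions -/

variable {α : Type} [Primcodable α]

theorem primrec_pointed (κ : ProductKind) {d n : α → ℕ} {T : α → AutomatonTable}
    {p : α → PolyCode} (hd : Primrec d) (hn : Primrec n) (hT : Primrec T) (hp : Primrec p) :
    Primrec fun x => pointed κ (d x) (n x) (T x) (p x) := by
  refine hn.pair (primrec_build hd (Primrec.succ.comp hn) ?_ ?_)
  · refine Primrec.ite (Primrec.eq.comp Primrec.snd (Primrec.const 0)) ?_ ?_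
    · exact (PolyCode.primrec_evalCode
        (primrec_out (hn.comp Primrec.fst) (hT.comp Primrec.fst) Primrec.snd).to₂ hp).comp
        Primrec.fst
    · exact primrec_out (hn.comp Primrec.fst) (hT.comp Primrec.fst)
        (Primrec.pred.comp Primrec.snd)
  · refine (PolyCode.primrec_renameVars Primrec.succ).comp
      (Primrec.ite (Primrec.eq.comp Primrec.snd (Primrec.const 0)) ?_ ?_)
    · refine PolyCode.primrec_extend κ (Primrec₂.mk ?_) (hp.comp (Primrec.fst.comp Primrec.fst))
      exact primrec_step (hn.comp (Primrec.fst.comp (Primrec.fst.comp Primrec.fst)))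
        (hT.comp (Primrec.fst.comp (Primrec.fst.comp Primrec.fst)))
        (Primrec.snd.comp (Primrec.fst.comp Primrec.fst)) Primrec.snd
    · exact primrec_step (hn.comp (Primrec.fst.comp Primrec.fst))
        (hT.comp (Primrec.fst.comp Primrec.fst)) (Primrec.snd.comp Primrec.fst)
        (Primrec.pred.comp Primrec.snd)

theorem primrecPred_even {i : α → ℕ} (hi : Primrec i) : PrimrecPred fun x => i x % 2 = 0 :=
  Primrec.eq.comp (Primrec.nat_mod.comp hi (Primrec.const 2)) (Primrec.const 0)

theorem primrec_half {i : α → ℕ} (hi : Primrec i) : Primrec fun x => i x / 2 :=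
  Primrec.nat_div.comp hi (Primrec.const 2)

theorem primrec_union {d n₁ n₂ : α → ℕ} {T₁ T₂ : α → AutomatonTable} (hd : Primrec d)
    (hn₁ : Primrec n₁) (hn₂ : Primrec n₂) (hT₁ : Primrec T₁) (hT₂ : Primrec T₂) :
    Primrec fun x => union (d x) (n₁ x) (n₂ x) (T₁ x) (T₂ x) := by
  refine primrec_build hd (Primrec.nat_double.comp (Primrec.nat_add.comp hn₁ hn₂)) ?_ ?_
  · exact Primrec.ite (primrecPred_even Primrec.snd)
      (primrec_out (hn₁.comp Primrec.fst) (hT₁.comp Primrec.fst) (primrec_half Primrec.snd))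
      (primrec_out (hn₂.comp Primrec.fst) (hT₂.comp Primrec.fst) (primrec_half Primrec.snd))
  · have h {n : α → ℕ} {T : α → AutomatonTable} (hn : Primrec n) (hT : Primrec T) :
        Primrec fun x : (α × ℕ) × ℕ => (T x.1.1).step (n x.1.1) x.1.2 (x.2 / 2) :=
      primrec_step (hn.comp (Primrec.fst.comp Primrec.fst))
        (hT.comp (Primrec.fst.comp Primrec.fst)) (Primrec.snd.comp Primrec.fst)
        (primrec_half Primrec.snd)
    exact Primrec.ite (primrecPred_even Primrec.snd)
      ((PolyCode.primrec_renameVars Primrec.nat_double).comp (h hn₁ hT₁))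
      ((PolyCode.primrec_renameVars Primrec.nat_double_succ).comp (h hn₂ hT₂))

theorem primrec_rightStep : Primrec rightStep :=
  Primrec.ite (primrecPred_even Primrec.id) (PolyCode.primrec_var.comp Primrec.succ)
    (Primrec.const _)

theorem primrec_rightAutomaton (κ : ProductKind) {d n a : α → ℕ} {T : α → AutomatonTable}
    (hd : Primrec d) (hn : Primrec n) (hT : Primrec T) (ha : Primrec a) :
    Primrec fun x => rightAutomaton κ (d x) (n x) (T x) (a x) := by
  refine primrec_build hd (Primrec.nat_double.comp hn) ?_ ?_
  · refine Primrec.ite (primrecPred_even Primrec.snd)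
      (primrec_out (hn.comp Primrec.fst) (hT.comp Primrec.fst) (primrec_half Primrec.snd)) ?_
    refine PolyCode.primrec_evalCode (Primrec₂.mk ?_) ?_
    · exact primrec_out (hn.comp (Primrec.fst.comp Primrec.fst))
        (hT.comp (Primrec.fst.comp Primrec.fst)) Primrec.snd
    · exact primrec_step (hn.comp Primrec.fst) (hT.comp Primrec.fst) (ha.comp Primrec.fst)
        (primrec_half Primrec.snd)
  · have h : Primrec fun x : (α × ℕ) × ℕ =>
        ((T x.1.1).step (n x.1.1) x.1.2 (x.2 / 2)).renameVars (fun j => 2 * j) :=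
      (PolyCode.primrec_renameVars Primrec.nat_double).comp
        (primrec_step (hn.comp (Primrec.fst.comp Primrec.fst))
        (hT.comp (Primrec.fst.comp Primrec.fst)) (Primrec.snd.comp Primrec.fst)
        (primrec_half Primrec.snd))
    exact Primrec.ite (primrecPred_even Primrec.snd) h
      (PolyCode.primrec_extend κ (primrec_rightStep.comp Primrec.snd).to₂ h)

end AutomatonTable

/-! ### Decidability of zeroness -/

/-- The projection of a primitive recursive relation is recursively enumerable, by a search through
the codes of witnesses. -/
theorem REPred.exists_of_primrecRel {α β : Type} [Primcodable α] [Primcodable β]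
    {R : α → β → Prop} (hR : PrimrecRel R) : REPred fun a => ∃ b, R a b := by
  classical
  have hR : Primrec fun x : α × β => decide (R x.1 x.2) := PrimrecPred.decide hR
  have h : Primrec₂ fun (a : α) (n : ℕ) =>
      (Encodable.decode n : Option β).bind fun b => if R a b then some () else none := by
    refine Primrec.option_bind (Primrec.decode.comp Primrec.snd) ?_
    exact Primrec.ite (hR.comp ((Primrec.fst.comp Primrec.fst).pair Primrec.snd)).primrecPred
      (Primrec.const _) (Primrec.const _)
  refine (Partrec.rfindOpt h.to_comp).dom_re.of_eq fun a => ?_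
  rw [Nat.rfindOpt_dom]
  constructor
  · rintro ⟨n, _, h⟩
    obtain ⟨b, _, hb⟩ := Option.bind_eq_some_iff.1 (Option.mem_def.1 h)
    exact ⟨b, by by_contra hn; simp [hn] at hb⟩
  · rintro ⟨b, hb⟩
    exact ⟨Encodable.encode b, (), by simp [hb]⟩

namespace ProductKind

variable {σ L : Type} (κ : ProductKind)

/-- If the transitions map a set of polynomials into the ideal it generates, then they preserve
this ideal. -/
theorem extend_mem_span {s : σ → MvPolynomial σ ℚ} {S : Set (MvPolynomial σ ℚ)}
    (h : ∀ p ∈ S, κ.extend s p ∈ Ideal.span S) {q : MvPolynomial σ ℚ} (hq : q ∈ Ideal.span S) :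
    κ.extend s q ∈ Ideal.span S := by
  induction hq using Submodule.span_induction with
  | mem p hp => exact h p hp
  | zero => simp
  | add p q _ _ hp hq => rw [map_add]; exact add_mem hp hq
  | smul r p hp ih =>
    rw [smul_eq_mul, extend_mul]
    exact add_mem (nsmul_mem (Ideal.mul_mem_left _ _ ih) _)
      (nsmul_mem (add_mem (Ideal.mul_mem_left _ _ hp) (Ideal.mul_mem_left _ _ ih)) _)

/-- A configuration in an invariant ideal on which the output vanishes has the series zero. -/
theorem config_eq_zero_of_mem_span {s : L → σ → MvPolynomial σ ℚ} {F : σ → ℚ}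
    {S : Set (MvPolynomial σ ℚ)} (h : ∀ a, ∀ p ∈ S, κ.extend (s a) p ∈ Ideal.span S)
    (hF : ∀ p ∈ S, eval F p = 0) {α : MvPolynomial σ ℚ} (hα : α ∈ Ideal.span S) (w : List L) :
    κ.config s F w α = 0 := by
  induction w generalizing α with
  | nil =>
    have : Ideal.span S ≤ RingHom.ker (eval F) := Ideal.span_le.2 fun p hp => hF p hp
    exact this hα
  | cons a w ih => exact ih (κ.extend_mem_span (h a) hα)

/-- If a configuration has the series zero, then it lies in a finitely generated invariant ideal
on which the output vanishes. -/
theorem exists_finset_of_config_eq_zero [Finite σ] {s : L → σ → MvPolynomial σ ℚ} {F : σ → ℚ}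
    {α : MvPolynomial σ ℚ} (h : ∀ w, κ.config s F w α = 0) :
    ∃ S : Finset (MvPolynomial σ ℚ), α ∈ Ideal.span (S : Set (MvPolynomial σ ℚ)) ∧
      ∀ q ∈ Ideal.span (S : Set (MvPolynomial σ ℚ)), eval F q = 0 ∧
        ∀ a, κ.extend (s a) q ∈ Ideal.span (S : Set (MvPolynomial σ ℚ)) := by
  obtain ⟨S, hS⟩ := (inferInstance : IsNoetherianRing (MvPolynomial σ ℚ)).noetherian
    (Ideal.span (Set.range fun w => κ.extendWord s w α))
  refine ⟨S, ?_, fun q hq => ?_⟩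
  · rw [Ideal.span, hS]
    exact Submodule.subset_span ⟨[], rfl⟩
  · rw [Ideal.span, hS] at hq ⊢
    constructor
    · have : Ideal.span (Set.range fun w => κ.extendWord s w α) ≤ RingHom.ker (eval F) :=
        Ideal.span_le.2 fun _ ⟨w, hw⟩ => hw ▸ h w
      exact this hq
    · intro a
      apply κ.extend_mem_span _ hq
      rintro _ ⟨w, rfl⟩
      exact Ideal.subset_span ⟨w ++ [a], by simp [extendWord]⟩

end ProductKind

namespace PolyCode

/-- The linear combination of the polynomials presented by `H`; a pair `(q, i)` in `l`
contributes the multiple by `q` of the entry of `H` with index `i`. -/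
def combination (H : List PolyCode) (l : List (PolyCode × ℕ)) : PolyCode :=
  l.flatMap fun e => mul e.1 (H.getD e.2 [])

theorem primrec_combination : Primrec₂ combination :=
  Primrec.list_flatMap Primrec.snd (primrec_mul.comp (Primrec.fst.comp Primrec.snd)
    ((Primrec.list_getD _).comp (Primrec.fst.comp Primrec.fst) (Primrec.snd.comp Primrec.snd)))

/-- The ideal of polynomials in `n` variables generated by a list of presented polynomials. -/
noncomputable def idealOf (n : ℕ) (H : List PolyCode) : Ideal (MvPolynomial (Fin n) ℚ) :=
  Ideal.span (toPoly n '' {p | p ∈ H})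

theorem toPoly_nil (n : ℕ) : toPoly n [] = 0 := rfl

theorem toPoly_mem_idealOf_getD (n : ℕ) (H : List PolyCode) (i : ℕ) :
    toPoly n (H.getD i []) ∈ idealOf n H := by
  by_cases h : i < H.length
  · rw [List.getD_eq_getElem _ _ h]
    exact Ideal.subset_span ⟨_, List.getElem_mem h, rfl⟩
  · rw [List.getD_eq_default _ _ (by omega), toPoly_nil]
    exact zero_mem _

theorem toPoly_append (n : ℕ) (p q : PolyCode) :
    toPoly n (p ++ q) = toPoly n p + toPoly n q := by
  simp only [toPoly_eq_truncate, natPoly_append, map_add]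

theorem toPoly_mul (n : ℕ) (p q : PolyCode) : toPoly n (mul p q) = toPoly n p * toPoly n q := by
  simp only [toPoly_eq_truncate, natPoly_mul, map_mul]

theorem toPoly_combination_cons (n : ℕ) (H : List PolyCode) (e : PolyCode × ℕ)
    (l : List (PolyCode × ℕ)) : toPoly n (combination H (e :: l)) =
      toPoly n e.1 * toPoly n (H.getD e.2 []) + toPoly n (combination H l) := by
  rw [← toPoly_mul, ← toPoly_append]
  rfl

theorem toPoly_combination_mem (n : ℕ) (H : List PolyCode) (l : List (PolyCode × ℕ)) :
    toPoly n (combination H l) ∈ idealOf n H := by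
  induction l with
  | nil => exact zero_mem _
  | cons e l ih =>
    rw [toPoly_combination_cons]
    exact add_mem (Ideal.mul_mem_left _ _ (toPoly_mem_idealOf_getD n H e.2)) ih

theorem exists_combination (n : ℕ) (H : List PolyCode) {q : MvPolynomial (Fin n) ℚ}
    (hq : q ∈ idealOf n H) : ∃ l, toPoly n (combination H l) = q := by
  induction hq using Submodule.span_induction with
  | mem q hq =>
    obtain ⟨p, hp, rfl⟩ := hq
    obtain ⟨i, hi, rfl⟩ := List.getElem_of_mem hp
    obtain ⟨r, hr⟩ := toPoly_surjective n 1
    exact ⟨[(r, i)], by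
      rw [toPoly_combination_cons, hr, List.getD_eq_getElem _ _ hi, one_mul]
      exact add_zero _⟩
  | zero => exact ⟨[], rfl⟩
  | add p q _ _ hp hq =>
    obtain ⟨l, rfl⟩ := hp
    obtain ⟨l', rfl⟩ := hq
    exact ⟨l ++ l', by rw [← toPoly_append]; simp [combination]⟩
  | smul r p _ hp =>
    obtain ⟨l, rfl⟩ := hp
    obtain ⟨r, rfl⟩ := toPoly_surjective n r
    refine ⟨l.map fun e => (mul r e.1, e.2), ?_⟩
    rw [smul_eq_mul]
    -- the induction on `l` concerns all lists, whether or not the combination is in the ideal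
    clear * -
    induction l with
    | nil => exact (mul_zero _).symm
    | cons e l ih =>
      rw [List.map_cons, toPoly_combination_cons, toPoly_combination_cons, ih, toPoly_mul]
      ring

end PolyCode

namespace ProductAutomatonCode

open PolyCode

/-- A certificate for zeroness: polynomials that generate an ideal together with
the distinguished nonterminal, and, for every letter and every generator, the coefficients of
a linear combination of the generators. -/
abbrev ZeroCertificate : Type := List PolyCode × List (List (List (PolyCode × ℕ)))

/-- The condition on a certificate: the output vanishes on the generators, and the transition of
every generator by every letter is the given linear combination of the generators. -/
def IsZeroCertificate (κ : ProductKind) (x : ℕ × ProductAutomatonCode) (z : ZeroCertificate) :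
    Prop :=
  (∀ p ∈ var 0 :: z.1, (p.evalCode (AutomatonTable.out (x.2.1 + 1) x.2.2)).val = 0) ∧
  ∀ a ∈ List.range x.1, ∀ i ∈ List.range (z.1.length + 1),
    toPoly (x.2.1 + 1)
      (((var 0 :: z.1).getD i []).extend κ (AutomatonTable.step (x.2.1 + 1) x.2.2 a) ++
        scale .negOne (combination (var 0 :: z.1) ((z.2.getD a []).getD i []))) = 0

theorem toPoly_append_scale_negOne_eq_zero_iff (n : ℕ) (p q : PolyCode) :
    toPoly n (p ++ scale .negOne q) = 0 ↔ toPoly n p = toPoly n q := by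
  simp only [toPoly_eq_truncate, natPoly_append, natPoly_scale, RatCode.val_negOne, map_neg, C_1,
    neg_mul, one_mul, ← sub_eq_add_neg, map_sub, sub_eq_zero]

theorem primrecRel_isZeroCertificate (κ : ProductKind) : PrimrecRel (IsZeroCertificate κ) := by
  have hH : Primrec fun y : (ℕ × ProductAutomatonCode) × ZeroCertificate => var 0 :: y.2.1 :=
    Primrec.list_cons.comp (Primrec.const _) (Primrec.fst.comp Primrec.snd)
  have hn : Primrec fun y : (ℕ × ProductAutomatonCode) × ZeroCertificate => y.1.2.1 + 1 :=
    Primrec.succ.comp (Primrec.fst.comp (Primrec.snd.comp Primrec.fst))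
  have hT : Primrec fun y : (ℕ × ProductAutomatonCode) × ZeroCertificate => y.1.2.2 :=
    Primrec.snd.comp (Primrec.snd.comp Primrec.fst)
  refine PrimrecPred.and (PrimrecRel.forall_mem_of_primrec hH ?_)
    (PrimrecRel.forall_mem_of_primrec
      (Primrec.list_range.comp (Primrec.fst.comp Primrec.fst)) ?_)
  · refine RatCode.primrecPred_val_eq_zero.comp (primrec_evalCode (Primrec₂.mk ?_) Primrec.snd)
    exact AutomatonTable.primrec_out (hn.comp (Primrec.fst.comp Primrec.fst))
      (hT.comp (Primrec.fst.comp Primrec.fst)) Primrec.snd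
  · refine PrimrecRel.forall_mem_of_primrec (Primrec.list_range.comp (Primrec.succ.comp
      (Primrec.list_length.comp (Primrec.fst.comp (Primrec.snd.comp Primrec.fst))))) ?_
    refine PrimrecRel.comp primrecRel_toPoly_eq_zero
      (hn.comp (Primrec.fst.comp Primrec.fst)) ?_
    refine Primrec.list_append.comp (primrec_extend κ (Primrec₂.mk ?_) ?_)
      (primrec_scale.comp (Primrec.const _) (primrec_combination.comp
        (hH.comp (Primrec.fst.comp Primrec.fst)) ?_))
    · exact AutomatonTable.primrec_step
        (hn.comp (Primrec.fst.comp (Primrec.fst.comp Primrec.fst)))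
        (hT.comp (Primrec.fst.comp (Primrec.fst.comp Primrec.fst)))
        (Primrec.snd.comp (Primrec.fst.comp Primrec.fst)) Primrec.snd
    · exact (Primrec.list_getD _).comp (hH.comp (Primrec.fst.comp Primrec.fst)) Primrec.snd
    · exact (Primrec.list_getD _).comp ((Primrec.list_getD _).comp
        (Primrec.snd.comp (Primrec.snd.comp (Primrec.fst.comp Primrec.fst)))
        (Primrec.snd.comp Primrec.fst)) Primrec.snd

theorem toPoly_var_zero (n : ℕ) : toPoly (n + 1) (var 0) = X 0 := by
  simp [toPoly_eq_truncate, truncate]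

theorem series_eq_zero_of_isZeroCertificate {κ : ProductKind} {d : ℕ} {c : ProductAutomatonCode}
    {z : ZeroCertificate} (h : IsZeroCertificate κ (d, c) z) :
    ProductAutomatonCode.series κ d c = 0 := by
  funext w
  rw [series_eq_finConfig, ProductKind.config_map]
  apply κ.config_eq_zero_of_mem_span (S := toPoly (c.1 + 1) '' {p | p ∈ var 0 :: z.1})
  · rintro a _ ⟨p, hp, rfl⟩
    obtain ⟨i, hi, rfl⟩ := List.getElem_of_mem hp
    have h1 := h.2 a (List.mem_range.2 a.2) i (List.mem_range.2 hi)
    rw [toPoly_append_scale_negOne_eq_zero_iff, List.getD_eq_getElem _ _ hi,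
      AutomatonTable.toPoly_extend] at h1
    exact h1 ▸ toPoly_combination_mem _ _ _
  · rintro _ ⟨p, hp, rfl⟩
    rw [← AutomatonTable.val_evalCode_out]
    exact h.1 p hp
  · exact Ideal.subset_span ⟨var 0, List.mem_cons_self, toPoly_var_zero _⟩

theorem exists_isZeroCertificate {κ : ProductKind} {d : ℕ} {c : ProductAutomatonCode}
    (h : ProductAutomatonCode.series κ d c = 0) : ∃ z, IsZeroCertificate κ (d, c) z := by
  obtain ⟨S, hX, hS⟩ := κ.exists_finset_of_config_eq_zero (L := Fin d)
    (s := fun a => AutomatonTable.finStep (c.1 + 1) c.2 a)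
    (F := AutomatonTable.finOut (c.1 + 1) c.2) (α := X 0)
    fun w => by rw [← ProductKind.config_map, ← series_eq_finConfig, h, Pi.zero_apply]
  choose code hcode using toPoly_surjective (c.1 + 1)
  let G : List PolyCode := S.toList.map code
  have hI : idealOf (c.1 + 1) (var 0 :: G) = Ideal.span (S : Set (MvPolynomial _ ℚ)) := by
    apply le_antisymm
    · rw [idealOf, Ideal.span_le]
      rintro _ ⟨p, hp, rfl⟩
      rcases List.mem_cons.1 hp with rfl | hp
      · rw [toPoly_var_zero]
        exact hX
      · obtain ⟨q, hq, rfl⟩ := List.mem_map.1 hp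
        rw [hcode]
        exact Ideal.subset_span (Finset.mem_toList.1 hq)
    · rw [Ideal.span_le]
      intro q hq
      exact Ideal.subset_span ⟨code q, List.mem_cons_of_mem _
        (List.mem_map_of_mem (Finset.mem_toList.2 hq)), hcode q⟩
  rw [← hI] at hS
  have hcomb : ∀ a i, ∃ l, a < d → toPoly (c.1 + 1) (combination (var 0 :: G) l) =
      toPoly (c.1 + 1) (((var 0 :: G).getD i []).extend κ
        (AutomatonTable.step (c.1 + 1) c.2 a)) := by
    intro a i
    by_cases ha : a < d
    · obtain ⟨l, hl⟩ := exists_combination _ _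
        ((hS _ (toPoly_mem_idealOf_getD (c.1 + 1) (var 0 :: G) i)).2 ⟨a, ha⟩)
      exact ⟨l, fun _ => hl.trans (AutomatonTable.toPoly_extend κ _ _ a _).symm⟩
    · exact ⟨[], fun h => absurd h ha⟩
  choose l hl using hcomb
  refine ⟨(G, (List.range d).map fun a => (List.range (G.length + 1)).map (l a)), ?_, ?_⟩
  · intro p hp
    rw [AutomatonTable.val_evalCode_out]
    exact (hS _ (Ideal.subset_span ⟨p, hp, rfl⟩)).1
  · intro a ha i hi
    rw [List.mem_range] at ha hi
    have e : ((((List.range d).map fun a => (List.range (G.length + 1)).map (l a)).getD a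
        []).getD i []) = l a i := by
      simp only [List.getD_eq_getElem?_getD]
      simp only at hi ha
      simp [ha, hi]
    rw [toPoly_append_scale_negOne_eq_zero_iff]
    simp only [e]
    exact (hl a i ha).symm

/-- The coefficient of a word in the series recognised by a presented automaton. -/
def coefficient (κ : ProductKind) (c : ProductAutomatonCode) (w : List ℕ) : RatCode :=
  (w.foldl (fun p a => p.extend κ (AutomatonTable.step (c.1 + 1) c.2 a)) (var 0)).evalCode
    (AutomatonTable.out (c.1 + 1) c.2)

theorem val_coefficient (κ : ProductKind) (d : ℕ) (c : ProductAutomatonCode)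
    (w : List (Fin d)) :
    (coefficient κ c (w.map Fin.val)).val = ProductAutomatonCode.series κ d c w := by
  have h : ∀ (v : List ℕ) (p : PolyCode), toPoly (c.1 + 1) (v.foldl
      (fun p a => p.extend κ (AutomatonTable.step (c.1 + 1) c.2 a)) p) =
      κ.extendWord (AutomatonTable.finStep (c.1 + 1) c.2) v (toPoly (c.1 + 1) p) := by
    intro v
    induction v with
    | nil => exact fun _ => rfl
    | cons a v ih =>
      intro p
      rw [List.foldl_cons, ih, AutomatonTable.toPoly_extend]
      rfl
  rw [coefficient, AutomatonTable.val_evalCode_out, h, toPoly_var_zero, series_eq_finConfig]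
  rfl

theorem primrec_coefficient (κ : ProductKind) : Primrec₂ (coefficient κ) := by
  have hn : Primrec fun y : ProductAutomatonCode × List ℕ => y.1.1 + 1 :=
    Primrec.succ.comp (Primrec.fst.comp Primrec.fst)
  have hT : Primrec fun y : ProductAutomatonCode × List ℕ => y.1.2 :=
    Primrec.snd.comp Primrec.fst
  have hrun : Primrec fun y : ProductAutomatonCode × List ℕ => y.2.foldl
      (fun p a => p.extend κ (AutomatonTable.step (y.1.1 + 1) y.1.2 a)) (var 0) := by
    have hstep : Primrec fun x : (ProductAutomatonCode × List ℕ) × (PolyCode × ℕ) =>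
        x.2.1.extend κ (AutomatonTable.step (x.1.1.1 + 1) x.1.1.2 x.2.2) :=
      primrec_extend κ (Primrec₂.mk (AutomatonTable.primrec_step
        (hn.comp (Primrec.fst.comp Primrec.fst)) (hT.comp (Primrec.fst.comp Primrec.fst))
        (Primrec.snd.comp (Primrec.snd.comp Primrec.fst)) Primrec.snd))
        (Primrec.fst.comp Primrec.snd)
    exact Primrec.list_foldl Primrec.snd (Primrec.const _) hstep.to₂
  refine primrec_evalCode (Primrec₂.mk ?_) hrun
  exact AutomatonTable.primrec_out (hn.comp Primrec.fst) (hT.comp Primrec.fst) Primrec.snd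

/-- Zeroness is decidable: both zeroness and its negation have certificates. -/
theorem computablePred_series_eq_zero (κ : ProductKind) :
    ComputablePred fun x : ℕ × ProductAutomatonCode =>
      ProductAutomatonCode.series κ x.1 x.2 = 0 := by
  rw [ComputablePred.computable_iff_re_compl_re']
  constructor
  · exact (REPred.exists_of_primrecRel (primrecRel_isZeroCertificate κ)).of_eq fun x =>
      ⟨fun ⟨_, h⟩ => series_eq_zero_of_isZeroCertificate h, exists_isZeroCertificate⟩
  · have h : PrimrecRel fun (x : ℕ × ProductAutomatonCode) (w : List ℕ) =>
        (∀ a ∈ w, a < x.1) ∧ ¬ (coefficient κ x.2 w).val = 0 :=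
      PrimrecPred.and
        (PrimrecRel.forall_mem_of_primrec Primrec.snd
          (Primrec.nat_lt.comp Primrec.snd (Primrec.fst.comp (Primrec.fst.comp Primrec.fst))))
        (PrimrecPred.not (RatCode.primrecPred_val_eq_zero.comp
          ((primrec_coefficient κ).comp (Primrec.snd.comp Primrec.fst) Primrec.snd)))
    refine (REPred.exists_of_primrecRel h).of_eq fun x => ?_
    rw [funext_iff, not_forall]
    constructor
    · rintro ⟨w, hw, hne⟩
      lift w to List (Fin x.1) using hw
      exact ⟨w, by rwa [val_coefficient] at hne⟩
    · rintro ⟨w, hw⟩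
      exact ⟨w.map Fin.val, w.map_val_lt, by rwa [val_coefficient]⟩

end ProductAutomatonCode

/-! ### Commutativity in effective prevarieties -/

/-- Commutativity is generated by exchanging the first two letters and by moving the first letter
to the end. -/
theorem Series.isCommutative_iff {A : Type} (f : Series A) :
    f.IsCommutative ↔
      (∀ a b : A, (f.leftDeriv a).leftDeriv b = (f.leftDeriv b).leftDeriv a) ∧
      ∀ a : A, f.leftDeriv a = f.rightDeriv a := by
  constructor
  · intro h
    refine ⟨fun a b => funext fun w => h _ _ (List.Perm.swap _ _ _), fun a => funext fun w => ?_⟩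
    exact h _ _ (List.perm_append_singleton a w).symm
  · rintro ⟨hswap, hrot⟩
    have hrot1 (a : A) (w : List A) : f (a :: w) = f (w ++ [a]) := congrFun (hrot a) w
    have hrot2 (u v : List A) : f (u ++ v) = f (v ++ u) := by
      induction u generalizing v with
      | nil => simp
      | cons a u ih => rw [List.cons_append, hrot1, List.append_assoc, ih]; simp
    -- the common prefix `p` is rotated to the end when the first two letters are exchanged
    have key (u v : List A) (h : u.Perm v) : ∀ p, f (p ++ u) = f (p ++ v) := by
      induction h with
      | nil => exact fun _ => rfl
      | cons a _ ih => intro p; simpa using ih (p ++ [a])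
      | swap a b l =>
        intro p
        rw [hrot2, hrot2 p]
        exact congrFun (hswap b a) (l ++ p)
      | trans _ _ ih1 ih2 => exact fun p => (ih1 p).trans (ih2 p)
    exact fun u v h => key u v h []

theorem ComputablePred.and_of_computablePred {α : Type} [Primcodable α] {p q : α → Prop}
    (hp : ComputablePred p) (hq : ComputablePred q) : ComputablePred fun a => p a ∧ q a := by
  classical
  refine Computable.computablePred ?_
  exact (Primrec.and.to_comp.comp hp.decide hq.decide).of_eq fun a => by simp

theorem ComputablePred.comp_computable {α β : Type} [Primcodable α] [Primcodable β] {p : β → Prop}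
    (hp : ComputablePred p) {f : α → β} (hf : Computable f) : ComputablePred fun a => p (f a) := by
  classical
  exact Computable.computablePred (hp.decide.comp hf)

/-- Computable predicates are closed under bounded universal quantification. -/
theorem ComputablePred.forall_lt_of_computablePred {α : Type} [Primcodable α] {f : α → ℕ}
    {p : α → ℕ → Prop} (hf : Computable f) (hp : ComputablePred fun x : α × ℕ => p x.1 x.2) :
    ComputablePred fun a => ∀ n < f a, p a n := by
  classical
  refine Computable.computablePred ?_
  have hstep : Computable₂ fun (a : α) (x : ℕ × Bool) => decide (p a x.1) && x.2 :=
    Primrec.and.to_comp.comp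
      (hp.decide.comp (Computable.fst.pair (Computable.fst.comp Computable.snd)))
      (Computable.snd.comp Computable.snd)
  refine (Computable.nat_rec hf (Computable.const true) hstep).of_eq fun a => ?_
  induction f a with
  | zero => simp
  | succ n ih =>
    simp only [ih, Nat.lt_succ_iff_lt_or_eq, or_imp, forall_and, forall_eq, Bool.decide_and]
    exact Bool.and_comm _ _

/-- In an effective prevariety, commutativity is a finite conjunction of equalities of iterated
derivatives. -/
theorem IsEffectivePrevariety.commutativityDecidable {S : SeriesClass} {R : Type} [Primcodable R]
    {sem : (d : ℕ) → R → Series (Fin d)} (h : IsEffectivePrevariety S sem) :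
    CommutativityDecidable sem := by
  obtain ⟨opL, hopL, hL⟩ := h.computable_leftDeriv
  obtain ⟨opR, hopR, hR⟩ := h.computable_rightDeriv
  have hdec := h.decidable_eq
  have hswap : ComputablePred fun x : ℕ × R => ∀ a < x.1, ∀ b < x.1,
      sem x.1 (opL (x.1, b, opL (x.1, a, x.2))) = sem x.1 (opL (x.1, a, opL (x.1, b, x.2))) := by
    refine ComputablePred.forall_lt_of_computablePred Computable.fst
      (ComputablePred.forall_lt_of_computablePred (Computable.fst.comp Computable.fst)
        (hdec.comp_computable
          (f := fun x : ((ℕ × R) × ℕ) × ℕ => (x.1.1.1, opL (x.1.1.1, x.2, opL (x.1.1.1, x.1.2,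
            x.1.1.2)), opL (x.1.1.1, x.1.2, opL (x.1.1.1, x.2, x.1.1.2)))) ?_))
    have hd : Computable fun x : ((ℕ × R) × ℕ) × ℕ => x.1.1.1 :=
      Computable.fst.comp (Computable.fst.comp Computable.fst)
    have hr : Computable fun x : ((ℕ × R) × ℕ) × ℕ => x.1.1.2 :=
      Computable.snd.comp (Computable.fst.comp Computable.fst)
    have ha : Computable fun x : ((ℕ × R) × ℕ) × ℕ => x.1.2 := Computable.snd.comp Computable.fst
    have hb : Computable fun x : ((ℕ × R) × ℕ) × ℕ => x.2 := Computable.snd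
    exact hd.pair ((hopL.comp (hd.pair (hb.pair (hopL.comp (hd.pair (ha.pair hr)))))).pair
      (hopL.comp (hd.pair (ha.pair (hopL.comp (hd.pair (hb.pair hr)))))))
  have hrot : ComputablePred fun x : ℕ × R => ∀ a < x.1,
      sem x.1 (opL (x.1, a, x.2)) = sem x.1 (opR (x.1, a, x.2)) := by
    refine ComputablePred.forall_lt_of_computablePred Computable.fst
      (hdec.comp_computable
        (f := fun x : (ℕ × R) × ℕ => (x.1.1, opL (x.1.1, x.2, x.1.2), opR (x.1.1, x.2, x.1.2))) ?_)
    have hd : Computable fun x : (ℕ × R) × ℕ => x.1.1 := Computable.fst.comp Computable.fst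
    have hr : Computable fun x : (ℕ × R) × ℕ => x.1.2 := Computable.snd.comp Computable.fst
    have hx := hd.pair (Computable.snd.pair hr)
    exact hd.pair ((hopL.comp hx).pair (hopR.comp hx))
  refine (hswap.and_of_computablePred hrot).of_eq fun ⟨d, r⟩ => ?_
  rw [Series.isCommutative_iff]
  refine and_congr ⟨fun h a b => ?_, fun h a ha b hb => ?_⟩ ⟨fun h a => ?_, fun h a ha => ?_⟩
  · simpa only [hL] using h a a.2 b b.2
  · have hL' (a : ℕ) (ha : a < d) (r : R) :
        sem d (opL (d, a, r)) = (sem d r).leftDeriv ⟨a, ha⟩ := hL d ⟨a, ha⟩ r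
    simpa only [hL' a ha, hL' b hb] using h ⟨a, ha⟩ ⟨b, hb⟩
  · simpa only [hL, hR] using h a a.2
  · exact (hL d ⟨a, ha⟩ r).trans ((h ⟨a, ha⟩).trans (hR d ⟨a, ha⟩ r).symm)

/-! ### Effective prevarieties from operations on presentations -/

/-- The closure properties of a class follow from those of the presented series over the alphabets
`{0, …, d - 1}`. -/
theorem IsEffectivePrevariety.of_operations {S : SeriesClass} {R : Type} [Primcodable R]
    [Nonempty R] {sem : (d : ℕ) → R → Series (Fin d)}
    (mem_iff : ∀ (A : Type) [Finite A] (d : ℕ) (e : Fin d ≃ A) (f : Series A),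
      f ∈ S A ↔ ∃ r : R, sem d r = fun w => f (w.map e))
    (computable_add : ∃ op : ℕ × R × R → R, Computable op ∧
      ∀ d r s, sem d (op (d, r, s)) = sem d r + sem d s)
    (computable_smul : ∃ op : ℕ × RatCode × R → R, Computable op ∧
      ∀ d c r, sem d (op (d, c, r)) = RatCode.val c • sem d r)
    (computable_leftDeriv : ∃ op : ℕ × ℕ × R → R, Computable op ∧
      ∀ d (a : Fin d) r, sem d (op (d, a, r)) = (sem d r).leftDeriv a)
    (computable_rightDeriv : ∃ op : ℕ × ℕ × R → R, Computable op ∧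
      ∀ d (a : Fin d) r, sem d (op (d, a, r)) = (sem d r).rightDeriv a)
    (decidable_zero : ComputablePred fun x : ℕ × R => sem x.1 x.2 = 0) :
    IsEffectivePrevariety S sem := by
  refine ⟨?_, mem_iff, computable_add, computable_smul, computable_leftDeriv,
    computable_rightDeriv, ?_⟩
  · obtain ⟨opA, -, hA⟩ := computable_add
    obtain ⟨opS, -, hS⟩ := computable_smul
    obtain ⟨opL, -, hL⟩ := computable_leftDeriv
    obtain ⟨opR, -, hR⟩ := computable_rightDeriv
    have hequiv (A : Type) [Finite A] : ∃ d : ℕ, Nonempty (Fin d ≃ A) := by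
      obtain ⟨d, ⟨e⟩⟩ := Finite.exists_equiv_fin A
      exact ⟨d, ⟨e.symm⟩⟩
    constructor
    · intro A _
      obtain ⟨d, ⟨e⟩⟩ := hequiv A
      obtain ⟨r⟩ := ‹Nonempty R›
      refine (mem_iff A d e 0).2 ⟨opS (d, (0, 0, 0), r), ?_⟩
      rw [hS, RatCode.val_zero, zero_smul]
      rfl
    · intro A _ f g hf hg
      obtain ⟨d, ⟨e⟩⟩ := hequiv A
      obtain ⟨r, hr⟩ := (mem_iff A d e f).1 hf
      obtain ⟨s, hs⟩ := (mem_iff A d e g).1 hg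
      exact (mem_iff A d e _).2 ⟨opA (d, r, s), by rw [hA, hr, hs]; rfl⟩
    · intro A _ c f hf
      obtain ⟨d, ⟨e⟩⟩ := hequiv A
      obtain ⟨r, hr⟩ := (mem_iff A d e f).1 hf
      obtain ⟨q, rfl⟩ := RatCode.val_surjective c
      exact (mem_iff A d e _).2 ⟨opS (d, q, r), by rw [hS, hr]; rfl⟩
    · intro A _ a f hf
      obtain ⟨d, ⟨e⟩⟩ := hequiv A
      obtain ⟨r, hr⟩ := (mem_iff A d e f).1 hf
      refine (mem_iff A d e _).2 ⟨opL (d, e.symm a, r), ?_⟩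
      rw [hL, hr]
      funext w
      simp [Series.leftDeriv]
    · intro A _ a f hf
      obtain ⟨d, ⟨e⟩⟩ := hequiv A
      obtain ⟨r, hr⟩ := (mem_iff A d e f).1 hf
      refine (mem_iff A d e _).2 ⟨opR (d, e.symm a, r), ?_⟩
      rw [hR, hr]
      funext w
      simp [Series.rightDeriv]
  · obtain ⟨opA, hopA, hA⟩ := computable_add
    obtain ⟨opS, hopS, hS⟩ := computable_smul
    have hdiff : Computable fun x : ℕ × R × R =>
        (x.1, opA (x.1, x.2.1, opS (x.1, RatCode.negOne, x.2.2))) :=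
      Computable.fst.pair (hopA.comp (Computable.fst.pair
        ((Computable.fst.comp Computable.snd).pair
          (hopS.comp (Computable.fst.pair ((Computable.const _).pair
            (Computable.snd.comp Computable.snd)))))))
    refine (decidable_zero.comp_computable hdiff).of_eq fun ⟨d, r, s⟩ => ?_
    rw [hA, hS, RatCode.val_negOne, neg_one_smul, ← sub_eq_add_neg, sub_eq_zero]

namespace ProductAutomatonCode

open AutomatonTable

variable (κ : ProductKind)

theorem mem_recognised_iff (A : Type) [Finite A] (d : ℕ) (e : Fin d ≃ A) (f : Series A) :
    f ∈ recognised κ A ↔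
      ∃ c, ProductAutomatonCode.series κ d c = fun w => f (w.map e) := by
  constructor
  · rintro ⟨M, rfl⟩
    obtain ⟨c, hc⟩ := toAutomaton_surjective d ⟨M.k, M.output, fun a => M.step (e a)⟩
    refine ⟨c, ?_⟩
    rw [ProductAutomatonCode.series, hc]
    funext w
    exact (κ.config_map e M.step M.output w (X 0)).symm
  · rintro ⟨c, hc⟩
    refine ⟨⟨(toAutomaton d c).k, (toAutomaton d c).output,
      fun a => (toAutomaton d c).step (e.symm a)⟩, ?_⟩
    funext w
    refine (κ.config_map e.symm (toAutomaton d c).step (toAutomaton d c).output w (X 0)).symm.trans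
      ((congrFun hc (w.map e.symm)).trans ?_)
    simp

theorem computable_add : ∃ op : ℕ × ProductAutomatonCode × ProductAutomatonCode →
    ProductAutomatonCode, Computable op ∧ ∀ d r s,
      ProductAutomatonCode.series κ d (op (d, r, s)) =
        ProductAutomatonCode.series κ d r + ProductAutomatonCode.series κ d s := by
  refine ⟨fun x => pointed κ x.1 (2 * ((x.2.1.1 + 1) + (x.2.2.1 + 1)))
    (union x.1 (x.2.1.1 + 1) (x.2.2.1 + 1) x.2.1.2 x.2.2.2) (.var 0 ++ .var 1),
    Primrec.to_comp ?_, fun d r s => funext fun w => ?_⟩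
  · have hn₁ : Primrec fun x : ℕ × ProductAutomatonCode × ProductAutomatonCode => x.2.1.1 + 1 :=
      Primrec.succ.comp (Primrec.fst.comp (Primrec.fst.comp Primrec.snd))
    have hn₂ : Primrec fun x : ℕ × ProductAutomatonCode × ProductAutomatonCode => x.2.2.1 + 1 :=
      Primrec.succ.comp (Primrec.fst.comp (Primrec.snd.comp Primrec.snd))
    exact primrec_pointed κ Primrec.fst (Primrec.nat_double.comp (Primrec.nat_add.comp hn₁ hn₂))
      (primrec_union Primrec.fst hn₁ hn₂ (Primrec.snd.comp (Primrec.fst.comp Primrec.snd))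
        (Primrec.snd.comp (Primrec.snd.comp Primrec.snd))) (Primrec.const _)
  · have h := config_union κ (r.1 + 1) (s.1 + 1) r.2 s.2 w.map_val_lt (X 0)
    rw [rename_X, rename_X] at h
    rw [series_pointed, PolyCode.natPoly_append, PolyCode.natPoly_var, PolyCode.natPoly_var,
      config, ProductKind.config_add, Pi.add_apply, series_eq_config, series_eq_config,
      ← h.1, ← h.2]
    rfl

theorem computable_smul : ∃ op : ℕ × RatCode × ProductAutomatonCode → ProductAutomatonCode,
    Computable op ∧ ∀ d c r, ProductAutomatonCode.series κ d (op (d, c, r)) =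
      c.val • ProductAutomatonCode.series κ d r := by
  refine ⟨fun x => pointed κ x.1 (x.2.2.1 + 1) x.2.2.2 (.scale x.2.1 (.var 0)),
    Primrec.to_comp ?_, fun d c r => funext fun w => ?_⟩
  · exact primrec_pointed κ Primrec.fst
      (Primrec.succ.comp (Primrec.fst.comp (Primrec.snd.comp Primrec.snd)))
      (Primrec.snd.comp (Primrec.snd.comp Primrec.snd))
      (PolyCode.primrec_scale.comp (Primrec.fst.comp Primrec.snd) (Primrec.const _))
  · rw [series_pointed, PolyCode.natPoly_scale, PolyCode.natPoly_var, ← smul_eq_C_mul, config,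
      ProductKind.config_smul, Pi.smul_apply, series_eq_config]
    rfl

theorem computable_leftDeriv : ∃ op : ℕ × ℕ × ProductAutomatonCode → ProductAutomatonCode,
    Computable op ∧ ∀ d (a : Fin d) r, ProductAutomatonCode.series κ d (op (d, a, r)) =
      (ProductAutomatonCode.series κ d r).leftDeriv a := by
  refine ⟨fun x => pointed κ x.1 (x.2.2.1 + 1) x.2.2.2 (step (x.2.2.1 + 1) x.2.2.2 x.2.1 0),
    Primrec.to_comp ?_, fun d a r => funext fun w => ?_⟩
  · have hn : Primrec fun x : ℕ × ℕ × ProductAutomatonCode => x.2.2.1 + 1 :=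
      Primrec.succ.comp (Primrec.fst.comp (Primrec.snd.comp Primrec.snd))
    have hT : Primrec fun x : ℕ × ℕ × ProductAutomatonCode => x.2.2.2 :=
      Primrec.snd.comp (Primrec.snd.comp Primrec.snd)
    exact primrec_pointed κ Primrec.fst hn hT
      (primrec_step hn hT (Primrec.fst.comp Primrec.snd) (Primrec.const 0))
  · rw [series_pointed, Series.leftDeriv, series_eq_config, List.map_cons, config, config,
      ProductKind.config_cons, ProductKind.extend_X]

theorem computable_rightDeriv : ∃ op : ℕ × ℕ × ProductAutomatonCode → ProductAutomatonCode,
    Computable op ∧ ∀ d (a : Fin d) r, ProductAutomatonCode.series κ d (op (d, a, r)) =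
      (ProductAutomatonCode.series κ d r).rightDeriv a := by
  refine ⟨fun x => pointed κ x.1 (2 * (x.2.2.1 + 1))
    (rightAutomaton κ x.1 (x.2.2.1 + 1) x.2.2.2 x.2.1) (.var 1),
    Primrec.to_comp ?_, fun d a r => funext fun w => ?_⟩
  · have hn : Primrec fun x : ℕ × ℕ × ProductAutomatonCode => x.2.2.1 + 1 :=
      Primrec.succ.comp (Primrec.fst.comp (Primrec.snd.comp Primrec.snd))
    have hT : Primrec fun x : ℕ × ℕ × ProductAutomatonCode => x.2.2.2 :=
      Primrec.snd.comp (Primrec.snd.comp Primrec.snd)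
    exact primrec_pointed κ Primrec.fst (Primrec.nat_double.comp hn)
      (primrec_rightAutomaton κ Primrec.fst hn hT (Primrec.fst.comp Primrec.snd))
      (Primrec.const _)
  · rw [series_pointed, Series.rightDeriv, series_eq_config, List.map_append,
      PolyCode.natPoly_var]
    exact config_rightAutomaton κ (r.1 + 1) r.2 w.map_val_lt 0

theorem isEffectivePrevariety :
    IsEffectivePrevariety (recognised κ) (ProductAutomatonCode.series κ) :=
  .of_operations (mem_recognised_iff κ) (computable_add κ) (computable_smul κ)
    (computable_leftDeriv κ) (computable_rightDeriv κ) (computablePred_series_eq_zero κ)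

end ProductAutomatonCode

/-! ### Polynomial automata -/

theorem MvPolynomial.eval_aeval_eq_eval {σ τ : Type} (q : τ → ℚ) (s : σ → MvPolynomial τ ℚ)
    (p : MvPolynomial σ ℚ) : eval q (aeval s p) = eval (fun i => eval q (s i)) p := by
  induction p using MvPolynomial.induction_on with
  | C c => simp [MvPolynomial.algebraMap_eq]
  | add p r hp hr => simp only [map_add, hp, hr]
  | mul_X p i hp => simp only [map_mul, hp, aeval_X, eval_X]

/-- A polynomial automaton computes the same values as the Hadamard automaton with the same
transitions, which starts in the output polynomial and has the initial state as output function;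
the order in which the letters are read is reversed. -/
theorem PolynomialAutomaton.series_eq_config {A : Type} (M : PolynomialAutomaton A) (w : List A) :
    M.series w = ProductKind.hadamard.config M.step M.init w.reverse M.output := by
  have h : ∀ q, eval (M.act q w) M.output =
      ProductKind.hadamard.config M.step q w.reverse M.output := by
    induction w with
    | nil => exact fun _ => rfl
    | cons a w ih =>
      intro q
      rw [List.reverse_cons, ProductKind.config_concat]
      refine (ih fun i => eval q (M.step a i)).trans ?_
      exact (eval_aeval_eq_eval q (M.step a) _).symm
  exact h M.init

namespace PolynomialAutomatonCode

/-- The Hadamard automaton that recognises the reversal of the series of a polynomial automaton. -/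
def toHadamard (d : ℕ) (c : PolynomialAutomatonCode) : ProductAutomatonCode :=
  AutomatonTable.pointed .hadamard d c.1 (c.2.1, c.2.2.1) c.2.2.2

/-- The polynomial automaton that recognises the reversal of the series of a Hadamard automaton. -/
def ofHadamard (c : ProductAutomatonCode) : PolynomialAutomatonCode :=
  (c.1 + 1, c.2.1, c.2.2, .var 0)

theorem series_eq_finConfig (d : ℕ) (c : PolynomialAutomatonCode) (w : List (Fin d)) :
    PolynomialAutomatonCode.series d c w =
      ProductKind.hadamard.config (AutomatonTable.finStep c.1 (c.2.1, c.2.2.1))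
        (AutomatonTable.finOut c.1 (c.2.1, c.2.2.1)) (w.reverse.map Fin.val)
        (c.2.2.2.toPoly c.1) := by
  rw [ProductKind.config_map]
  exact (toAutomaton d c).series_eq_config w

theorem series_toHadamard (d : ℕ) (c : PolynomialAutomatonCode) :
    ProductAutomatonCode.series .hadamard d (toHadamard d c) =
      (PolynomialAutomatonCode.series d c).reversal := by
  funext w
  rw [Series.reversal, series_eq_finConfig, toHadamard, AutomatonTable.series_pointed,
    List.reverse_reverse, PolyCode.toPoly_eq_truncate, AutomatonTable.config_truncate]

theorem series_ofHadamard (d : ℕ) (c : ProductAutomatonCode) :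
    PolynomialAutomatonCode.series d (ofHadamard c) =
      (ProductAutomatonCode.series .hadamard d c).reversal := by
  funext w
  rw [Series.reversal, ProductAutomatonCode.series_eq_finConfig, series_eq_finConfig,
    ← ProductAutomatonCode.toPoly_var_zero]
  rfl

theorem primrec_toHadamard : Primrec₂ toHadamard :=
  have h2 : Primrec fun x : ℕ × PolynomialAutomatonCode => x.2.2 := Primrec.snd.comp Primrec.snd
  have h3 : Primrec fun x : ℕ × PolynomialAutomatonCode => x.2.2.2 := Primrec.snd.comp h2
  AutomatonTable.primrec_pointed .hadamard Primrec.fst (Primrec.fst.comp Primrec.snd)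
    ((Primrec.fst.comp h2).pair (Primrec.fst.comp h3)) (Primrec.snd.comp h3)

theorem primrec_ofHadamard : Primrec ofHadamard :=
  (Primrec.succ.comp Primrec.fst).pair ((Primrec.fst.comp Primrec.snd).pair
    ((Primrec.snd.comp Primrec.snd).pair (Primrec.const _)))

end PolynomialAutomatonCode

namespace Series

theorem reversal_reversal {A : Type} (f : Series A) : f.reversal.reversal = f := by
  funext w
  simp [reversal]

theorem reversal_leftDeriv {A : Type} (a : A) (f : Series A) :
    (f.leftDeriv a).reversal = f.reversal.rightDeriv a := by
  funext w
  simp [reversal, leftDeriv, rightDeriv]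

theorem reversal_rightDeriv {A : Type} (a : A) (f : Series A) :
    (f.rightDeriv a).reversal = f.reversal.leftDeriv a := by
  funext w
  simp [reversal, leftDeriv, rightDeriv]

end Series

namespace PolynomialAutomatonCode

theorem mem_recognisedPolynomial_iff (A : Type) [Finite A] (d : ℕ) (e : Fin d ≃ A)
    (f : Series A) :
    f ∈ recognisedPolynomial A ↔
      ∃ c, PolynomialAutomatonCode.series d c = fun w => f (w.map e) := by
  constructor
  · rintro ⟨M, rfl⟩
    obtain ⟨c, hc⟩ := toAutomaton_surjective d ⟨M.k, M.init, fun a => M.step (e a), M.output⟩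
    refine ⟨c, ?_⟩
    rw [PolynomialAutomatonCode.series, hc]
    funext w
    rw [PolynomialAutomaton.series_eq_config, PolynomialAutomaton.series_eq_config,
      ← List.map_reverse, ProductKind.config_map]
  · rintro ⟨c, hc⟩
    refine ⟨⟨(toAutomaton d c).k, (toAutomaton d c).init,
      fun a => (toAutomaton d c).step (e.symm a), (toAutomaton d c).output⟩, ?_⟩
    funext w
    have h := congrFun hc (w.map e.symm)
    rw [PolynomialAutomatonCode.series, PolynomialAutomaton.series_eq_config, ← List.map_reverse,
      ProductKind.config_map] at h
    rw [PolynomialAutomaton.series_eq_config]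
    refine h.trans ?_
    simp

theorem isEffectivePrevariety :
    IsEffectivePrevariety recognisedPolynomial PolynomialAutomatonCode.series := by
  have hconv {α : Type} [Primcodable α] {d : α → ℕ} {c : α → PolynomialAutomatonCode}
      (hd : Computable d) (hc : Computable c) : Computable fun x => toHadamard (d x) (c x) :=
    primrec_toHadamard.to_comp.comp hd hc
  have hback := primrec_ofHadamard.to_comp
  refine .of_operations mem_recognisedPolynomial_iff ?_ ?_ ?_ ?_ ?_
  · obtain ⟨op, hop, h⟩ := ProductAutomatonCode.computable_add .hadamard
    refine ⟨fun x => ofHadamard (op (x.1, toHadamard x.1 x.2.1, toHadamard x.1 x.2.2)),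
      hback.comp (hop.comp (Computable.fst.pair
        ((hconv Computable.fst (Computable.fst.comp Computable.snd)).pair
          (hconv Computable.fst (Computable.snd.comp Computable.snd))))), fun d r s => ?_⟩
    rw [series_ofHadamard, h, series_toHadamard, series_toHadamard]
    exact congrArg₂ (· + ·) (Series.reversal_reversal _) (Series.reversal_reversal _)
  · obtain ⟨op, hop, h⟩ := ProductAutomatonCode.computable_smul .hadamard
    refine ⟨fun x => ofHadamard (op (x.1, x.2.1, toHadamard x.1 x.2.2)),
      hback.comp (hop.comp (Computable.fst.pair ((Computable.fst.comp Computable.snd).pair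
        (hconv Computable.fst (Computable.snd.comp Computable.snd))))), fun d q r => ?_⟩
    rw [series_ofHadamard, h, series_toHadamard]
    exact congrArg (q.val • ·) (Series.reversal_reversal _)
  · obtain ⟨op, hop, h⟩ := ProductAutomatonCode.computable_rightDeriv .hadamard
    refine ⟨fun x => ofHadamard (op (x.1, x.2.1, toHadamard x.1 x.2.2)),
      hback.comp (hop.comp (Computable.fst.pair ((Computable.fst.comp Computable.snd).pair
        (hconv Computable.fst (Computable.snd.comp Computable.snd))))), fun d a r => ?_⟩
    rw [series_ofHadamard, h, series_toHadamard, Series.reversal_rightDeriv,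
      Series.reversal_reversal]
  · obtain ⟨op, hop, h⟩ := ProductAutomatonCode.computable_leftDeriv .hadamard
    refine ⟨fun x => ofHadamard (op (x.1, x.2.1, toHadamard x.1 x.2.2)),
      hback.comp (hop.comp (Computable.fst.pair ((Computable.fst.comp Computable.snd).pair
        (hconv Computable.fst (Computable.snd.comp Computable.snd))))), fun d a r => ?_⟩
    rw [series_ofHadamard, h, series_toHadamard, Series.reversal_leftDeriv,
      Series.reversal_reversal]
  · refine ((ProductAutomatonCode.computablePred_series_eq_zero .hadamard).comp_computable
      (Computable.fst.pair (hconv Computable.fst Computable.snd))).of_eq fun ⟨d, c⟩ => ?_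
    rw [series_toHadamard]
    exact ⟨fun h => (Series.reversal_reversal _).symm.trans (congrArg Series.reversal h),
      fun h => congrArg Series.reversal h⟩

end PolynomialAutomatonCode

theorem mem_recognisedPolynomial_iff_reversal (A : Type) [Finite A] (f : Series A) :
    f ∈ recognisedPolynomial A ↔ f.reversal ∈ recognised .hadamard A := by
  obtain ⟨d, ⟨e⟩⟩ := Finite.exists_equiv_fin A
  have hrev : Series.reversal (fun w : List (Fin d) => f (w.map e.symm)) =
      fun w => f.reversal (w.map e.symm) := by
    funext w
    simp [Series.reversal]
  rw [PolynomialAutomatonCode.mem_recognisedPolynomial_iff A d e.symm,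
    ProductAutomatonCode.mem_recognised_iff .hadamard A d e.symm, ← hrev]
  constructor
  · rintro ⟨c, hc⟩
    exact ⟨c.toHadamard d, by rw [PolynomialAutomatonCode.series_toHadamard, hc]⟩
  · rintro ⟨c, hc⟩
    exact ⟨.ofHadamard c, by
      rw [PolynomialAutomatonCode.series_ofHadamard, hc, Series.reversal_reversal]⟩

/-! ### Infiltration-finite series -/

namespace Series

variable {A : Type}

/-- The binomial transform of a series: the coefficient of `w` is the sum of the coefficients of
all subwords of `w`, with multiplicities. It turns the infiltration product into the pointwise
product. -/
def binomial : List A → Series A → ℚ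
  | [], f => f []
  | a :: w, f => binomial w f + binomial w (f.leftDeriv a)

theorem binomial_add (w : List A) (f g : Series A) :
    binomial w (f + g) = binomial w f + binomial w g := by
  induction w generalizing f g with
  | nil => rfl
  | cons a w ih =>
    have : (f + g).leftDeriv a = f.leftDeriv a + g.leftDeriv a := rfl
    simp only [binomial, this, ih]
    ring

theorem binomial_smul (w : List A) (c : ℚ) (f : Series A) :
    binomial w (c • f) = c * binomial w f := by
  induction w generalizing f with
  | nil => rfl
  | cons a w ih =>
    have : (c • f).leftDeriv a = c • f.leftDeriv a := rfl
    simp only [binomial, this, ih]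
    ring

theorem binomial_zero (w : List A) : binomial w (0 : Series A) = 0 := by
  simpa using binomial_smul w 0 0

theorem binomial_unit (w : List A) : binomial w (unit : Series A) = 1 := by
  induction w with
  | nil => rfl
  | cons a w ih =>
    have : (unit : Series A).leftDeriv a = 0 := rfl
    simp [binomial, this, ih, binomial_zero]

theorem binomial_infiltration (w : List A) (f g : Series A) :
    binomial w (infiltration f g) = binomial w f * binomial w g := by
  induction w generalizing f g with
  | nil => rfl
  | cons a w ih =>
    simp only [binomial, leftDeriv_infiltration, binomial_add, ih]
    ring

theorem binomial_injective {f g : Series A} (h : ∀ w, binomial w f = binomial w g) : f = g := by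
  funext u
  induction u generalizing f g with
  | nil => exact h []
  | cons a u ih =>
    refine ih (f := f.leftDeriv a) (g := g.leftDeriv a) fun w => ?_
    have h1 := h (a :: w)
    have h2 := h w
    simp only [binomial] at h1
    linarith

/-- The elements of the infiltration algebra generated by a family of series are polynomials in
this family; this is expressed on the side of the binomial transform. -/
theorem InfiltrationAdjoin.exists_polynomial {ι : Type} {g : ι → Series A} {G : Set (Series A)}
    (hG : G ⊆ Set.range g) {f : Series A} (hf : InfiltrationAdjoin G f) :
    ∃ p : MvPolynomial ι ℚ, ∀ w, binomial w f = eval (fun i => binomial w (g i)) p := by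
  induction hf with
  | gen f hf =>
    obtain ⟨i, rfl⟩ := hG hf
    exact ⟨X i, fun w => by rw [eval_X]⟩
  | one => exact ⟨1, fun w => by rw [binomial_unit, map_one]⟩
  | add _ _ _ _ hp hq =>
    obtain ⟨p, hp⟩ := hp
    obtain ⟨q, hq⟩ := hq
    exact ⟨p + q, fun w => by rw [binomial_add, hp, hq, map_add]⟩
  | smul c _ _ hp =>
    obtain ⟨p, hp⟩ := hp
    exact ⟨c • p, fun w => by rw [binomial_smul, hp, smul_eval]⟩
  | mul _ _ _ _ hp hq =>
    obtain ⟨p, hp⟩ := hp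
    obtain ⟨q, hq⟩ := hq
    exact ⟨p * q, fun w => by rw [binomial_infiltration, hp, hq, map_mul]⟩

end Series

namespace ProductAutomaton

open Series

variable {A : Type} (M : ProductAutomaton A)

theorem leftDeriv_configSeries (κ : ProductKind) (a : A) (α : MvPolynomial (Fin (M.k + 1)) ℚ) :
    (M.configSeries κ α).leftDeriv a = M.configSeries κ (κ.extend (M.step a) α) := rfl

theorem configSeries_add (κ : ProductKind) (α β : MvPolynomial (Fin (M.k + 1)) ℚ) :
    M.configSeries κ (α + β) = M.configSeries κ α + M.configSeries κ β :=
  funext fun w => κ.config_add M.step M.output w α β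

theorem configSeries_smul (κ : ProductKind) (c : ℚ) (α : MvPolynomial (Fin (M.k + 1)) ℚ) :
    M.configSeries κ (c • α) = c • M.configSeries κ α :=
  funext fun w => κ.config_smul M.step M.output w c α

theorem configSeries_infiltration_mul (α β : MvPolynomial (Fin (M.k + 1)) ℚ) :
    M.configSeries .infiltration (α * β) =
      infiltration (M.configSeries .infiltration α) (M.configSeries .infiltration β) := by
  funext w
  induction w generalizing α β with
  | nil => exact map_mul (eval M.output) α β
  | cons a w ih =>
    change (M.configSeries .infiltration (α * β)).leftDeriv a w =
      (infiltration _ _).leftDeriv a w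
    rw [leftDeriv_infiltration, leftDeriv_configSeries, leftDeriv_configSeries,
      leftDeriv_configSeries, (ProductKind.extend_infiltration _).2.2, configSeries_add,
      configSeries_add, Pi.add_apply, Pi.add_apply, ih, ih, ih]
    rfl

theorem configSeries_infiltration_one : M.configSeries .infiltration 1 = unit := by
  funext w
  cases w with
  | nil => exact map_one (eval M.output)
  | cons a w =>
    change (M.configSeries .infiltration 1).leftDeriv a w = 0
    rw [leftDeriv_configSeries, (ProductKind.extend_infiltration _).2.1,
      ← zero_smul ℚ (1 : MvPolynomial (Fin (M.k + 1)) ℚ), configSeries_smul, zero_smul,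
      Pi.zero_apply]

/-- The infiltration algebra generated by the series of the nonterminals consists of the series of
all configurations. -/
theorem infiltrationAdjoin_iff (f : Series A) :
    InfiltrationAdjoin (Set.range fun i => M.configSeries .infiltration (X i)) f ↔
      ∃ α, M.configSeries .infiltration α = f := by
  constructor
  · intro h
    induction h with
    | gen f hf =>
      obtain ⟨i, rfl⟩ := hf
      exact ⟨X i, rfl⟩
    | one => exact ⟨1, M.configSeries_infiltration_one⟩
    | add _ _ _ _ hα hβ =>
      obtain ⟨α, rfl⟩ := hα
      obtain ⟨β, rfl⟩ := hβ
      exact ⟨α + β, M.configSeries_add _ α β⟩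
    | smul c _ _ hα =>
      obtain ⟨α, rfl⟩ := hα
      exact ⟨c • α, M.configSeries_smul _ c α⟩
    | mul _ _ _ _ hα hβ =>
      obtain ⟨α, rfl⟩ := hα
      obtain ⟨β, rfl⟩ := hβ
      exact ⟨α * β, M.configSeries_infiltration_mul α β⟩
  · rintro ⟨α, rfl⟩
    induction α using MvPolynomial.induction_on with
    | C c =>
      rw [← mul_one (C c), ← smul_eq_C_mul, configSeries_smul, configSeries_infiltration_one]
      exact .smul c _ .one
    | add p q hp hq => rw [configSeries_add]; exact .add _ _ hp hq
    | mul_X p i hp =>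
      rw [configSeries_infiltration_mul]
      exact .mul _ _ hp (.gen _ ⟨i, rfl⟩)

/-- If the output and the transitions of an infiltration automaton describe the constant
coefficients and the left derivatives of series `g i`, then it recognises `g 0`. -/
theorem series_eq_of_binomial (g : Fin (M.k + 1) → Series A) (h_out : ∀ i, M.output i = g i [])
    (hstep : ∀ a i w, binomial w ((g i).leftDeriv a) =
      eval (fun j => binomial w (g j)) (M.step a i)) : M.series .infiltration = g 0 := by
  have key (w : List A) : ∀ α, binomial w (M.configSeries .infiltration α) =
      eval (fun i => binomial w (g i)) α := by
    induction w with
    | nil =>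
      intro α
      change eval M.output α = _
      rw [funext h_out]
      rfl
    | cons a w ih =>
      intro α
      have e : α + ProductKind.infiltration.extend (M.step a) α =
          aeval (fun i => X i + M.step a i) α := by
        simp [ProductKind.extend]
      rw [binomial, leftDeriv_configSeries, ih, ih, ← map_add, e, eval_aeval_eq_eval]
      simp only [map_add, eval_X, binomial, hstep]
  refine binomial_injective fun w => ?_
  rw [ProductAutomaton.series, key, eval_X]

end ProductAutomaton

theorem infiltrationFinite_eq_recognised : infiltrationFinite = recognised .infiltration := by
  funext A _
  ext f
  constructor
  · rintro ⟨G, hG, hf, hclosed⟩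
    -- `f` itself is put in front of the generators, as the series of the distinguished nonterminal
    let l := hG.toFinset.toList
    let g : Fin (l.length + 1) → Series A := (f :: l).get
    have hg : G ⊆ Set.range g := by
      intro x hx
      obtain ⟨i, hi⟩ := List.get_of_mem (List.mem_cons_of_mem f
        (Finset.mem_toList.2 (hG.mem_toFinset.2 hx)))
      exact ⟨i, hi⟩
    have hmem (i : Fin (l.length + 1)) : Series.InfiltrationAdjoin G (g i) := by
      rcases List.mem_cons.1 (List.get_mem (f :: l) i) with h | h
      · exact (show g i = f from h) ▸ hf
      · exact .gen _ (hG.mem_toFinset.1 (Finset.mem_toList.1 h))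
    choose p hp using fun a i => (hclosed a _ (hmem i)).exists_polynomial hg
    let M : ProductAutomaton A := ⟨l.length, fun i => g i [], p⟩
    exact ⟨M, M.series_eq_of_binomial g (fun _ => rfl) hp⟩
  · rintro ⟨M, rfl⟩
    refine ⟨_, Set.finite_range fun i => M.configSeries .infiltration (X i),
      (M.infiltrationAdjoin_iff _).2 ⟨_, rfl⟩, fun a g hg => ?_⟩
    obtain ⟨α, rfl⟩ := (M.infiltrationAdjoin_iff _).1 hg
    exact (M.infiltrationAdjoin_iff _).2 ⟨_, rfl⟩

theorem mainTheorem2 :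
    -- polynomial automata, and Hadamard automata, which recognise the reversed series
    IsEffectivePrevariety recognisedPolynomial PolynomialAutomatonCode.series ∧
    IsEffectivePrevariety (recognised .hadamard) (ProductAutomatonCode.series .hadamard) ∧
    (∀ (A : Type) [Finite A] (f : Series A),
      f ∈ recognisedPolynomial A ↔ f.reversal ∈ recognised .hadamard A) ∧
    -- shuffle automata
    IsEffectivePrevariety (recognised .shuffle) (ProductAutomatonCode.series .shuffle) ∧
    -- infiltration automata, and infiltration-finite series
    IsEffectivePrevariety (recognised .infiltration) (ProductAutomatonCode.series .infiltration) ∧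
    IsEffectivePrevariety infiltrationFinite (ProductAutomatonCode.series .infiltration) ∧
    -- the commutativity problems
    CommutativityDecidable PolynomialAutomatonCode.series ∧
    CommutativityDecidable (ProductAutomatonCode.series .hadamard) ∧
    CommutativityDecidable (ProductAutomatonCode.series .shuffle) ∧
    CommutativityDecidable (ProductAutomatonCode.series .infiltration) :=
  ⟨PolynomialAutomatonCode.isEffectivePrevariety,
    ProductAutomatonCode.isEffectivePrevariety .hadamard,
    mem_recognisedPolynomial_iff_reversal,
    ProductAutomatonCode.isEffectivePrevariety .shuffle,
    ProductAutomatonCode.isEffectivePrevariety .infiltration,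
    infiltrationFinite_eq_recognised ▸ ProductAutomatonCode.isEffectivePrevariety .infiltration,
    PolynomialAutomatonCode.isEffectivePrevariety.commutativityDecidable,
    (ProductAutomatonCode.isEffectivePrevariety .hadamard).commutativityDecidable,
    (ProductAutomatonCode.isEffectivePrevariety .shuffle).commutativityDecidable,
    (ProductAutomatonCode.isEffectivePrevariety .infiltration).commutativityDecidable⟩
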